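/- Let $(T_i)_{i\ge 1}$ be i.i.d. random variables with values in $\{1,2,\dots\}$ and law $P$ such that $K(n):=P(T_1=n)=L(n)\,n^{-(1+\alpha)}>0$ for all $n\ge 1$, where $\alpha\ge 0$ and $L$ is slowly varying at infinity; in particular $\sum_{n\ge1}K(n)=1$. Let $\tau_0=0$, $\tau_k=T_1+\dots+T_k$, $\tau=\{\tau_k:k\ge0\}$ and $\delta_n=\mathbf 1_{\{n\in\tau\}}$. Let $\omega=(\omega_n)_{n\ge0}$, with law $\mathbb P$, be a stationary Gaussian sequence, independent of $\tau$, with $\mathbb E(\omega_0)=0$ and $\mathbb E(\omega_0^2)=1$, and let $\rho_n=\operatorname{Cov}(\omega_0,\omega_n)$. For $\beta\ge0$, $h\in\mathbb R$ and $n\ge1$ put $$Z^{\omega}_{n,\beta,h}=E\Big[\exp\Big(\sum_{k=1}^n(\beta\omega_k+h)\delta_k\Big)\delta_n\Big],\qquad Z^a_{n,\beta,h}=\mathbb E\,Z^{\omega}_{n,\beta,h},$$ $$F^a(\beta,h)=\lim_{n\to\infty}\frac1n\log Z^a_{n,\beta,h},\qquad h^a_c(\beta)=\sup\{h\in\mathbb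 R:F^a(\beta,h)=0\}.$$ Assume $\sum_{n\ge1}|\rho_n|<\infty$. Then for all $\beta\ge0$ and $h\in\mathbb R$ the limit $F^a(\beta,h)$ exists and is finite, $h^a_c(\beta)$ is finite (the set $\{h:F^a(\beta,h)=0\}$ is non-empty and bounded above), and $$h_c^a(\beta)\ \sim\ -\frac{\beta^2}{2}\Big(1+2\sum_{n\ge1}\rho_n\,P(n\in\tau)\Big)\qquad\text{as }\beta\downarrow0 .$$ -/

import Mathlib

open MeasureTheory ProbabilityTheory Filter Topology

namespace Pinning

noncomputable section

/-- Slow variation at infinity: `L` is measurable, eventually positive, and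
`L (c x) / L x → 1` as `x → ∞` for every `c > 0`. -/
structure IsSlowlyVarying (L : ℝ → ℝ) : Prop where
  measurable : Measurable L
  eventually_pos : ∀ᶠ x in atTop, 0 < L x
  tendsto_ratio : ∀ c : ℝ, 0 < c → Tendsto (fun x => L (c * x) / L x) atTop (𝓝 1)

/-- `T 0, T 1, …` are i.i.d. random variables with values in the positive integers: the
interarrival times of the renewal process (the time `T i` here is traditionally `T_{i+1}`). -/
structure IsInterarrival {Ω : Type*} [MeasurableSpace Ω] (P : Measure Ω) (T : ℕ → Ω → ℕ) :
    Prop where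
  measurable : ∀ i, Measurable (T i)
  pos : ∀ i x, 0 < T i x
  indep : iIndepFun T P
  identDistrib : ∀ i, IdentDistrib (T i) (T 0) P P

/-- The common law of the interarrival times, `K(n) = P(T₁ = n)`. -/
def stepLaw {Ω : Type*} [MeasurableSpace Ω] (P : Measure Ω) (T : ℕ → Ω → ℕ) (n : ℕ) : ℝ :=
  P.real {x | T 0 x = n}

/-- The renewal times `τ_k = T₁ + ⋯ + T_k`, with `τ_0 = 0`. -/
def renewalTime {Ω : Type*} (T : ℕ → Ω → ℕ) (k : ℕ) (x : Ω) : ℕ :=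
  ∑ i ∈ Finset.range k, T i x

/-- The event `{n ∈ τ}`. -/
def renewalEvent {Ω : Type*} (T : ℕ → Ω → ℕ) (n : ℕ) : Set Ω :=
  {x | ∃ k, renewalTime T k x = n}

/-- The contact variable `δ_n`, the indicator of `{n ∈ τ}`. -/
def contact {Ω : Type*} (T : ℕ → Ω → ℕ) (n : ℕ) : Ω → ℝ :=
  (renewalEvent T n).indicator 1

/-- A stationary, jointly Gaussian sequence with `E(ω_0) = 0` and `E(ω_0 ^ 2) = 1`. -/
structure IsStationaryGaussianDisorder {Ω' : Type*} [MeasurableSpace Ω'] (Q : Measure Ω')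
    (ω : ℕ → Ω' → ℝ) : Prop where
  gaussian : IsGaussianProcess ω Q
  stationary : ∀ k, IdentDistrib (fun y n => ω (n + k) y) (fun y n => ω n y) Q Q
  mean_zero : ∫ y, ω 0 y ∂Q = 0
  second_moment : ∫ y, ω 0 y ^ 2 ∂Q = 1

/-- The correlations `ρ_n = Cov(ω_0, ω_n)`. -/
def correlation {Ω' : Type*} [MeasurableSpace Ω'] (Q : Measure Ω') (ω : ℕ → Ω' → ℝ) (n : ℕ) : ℝ :=
  covariance (ω 0) (ω n) Q

/-- The quenched partition function `Z_{n,β,h}^w = E(exp(∑_{k=1}^n (β w_k + h) δ_k) δ_n)` in a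
fixed environment `w`. -/
def quenchedPartition {Ω : Type*} [MeasurableSpace Ω] (P : Measure Ω) (T : ℕ → Ω → ℕ)
    (w : ℕ → ℝ) (n : ℕ) (β h : ℝ) : ℝ :=
  ∫ x, Real.exp (∑ k ∈ Finset.Icc 1 n, (β * w k + h) * contact T k x) * contact T n x ∂P

/-- The annealed partition function: the average of the quenched one over the disorder. The
disorder lives on its own probability space, hence is independent of the renewal process. -/
def annealedPartition {Ω Ω' : Type*} [MeasurableSpace Ω] [MeasurableSpace Ω'] (P : Measure Ω)
    (T : ℕ → Ω → ℕ) (Q : Measure Ω') (ω : ℕ → Ω' → ℝ) (n : ℕ) (β h : ℝ) : ℝ :=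
  ∫ y, quenchedPartition P T (fun k => ω k y) n β h ∂Q

/-- The annealed free energy `F^a(β,h) = lim (1/n) log Z^a_{n,β,h}`. -/
def annealedFreeEnergy {Ω Ω' : Type*} [MeasurableSpace Ω] [MeasurableSpace Ω'] (P : Measure Ω)
    (T : ℕ → Ω → ℕ) (Q : Measure Ω') (ω : ℕ → Ω' → ℝ) (β h : ℝ) : ℝ :=
  limUnder atTop (fun n : ℕ => 1 / (n : ℝ) * Real.log (annealedPartition P T Q ω n β h))

/-- The annealed critical curve `h_c^a(β) = sup {h : F^a(β,h) = 0}`. -/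
def annealedCriticalCurve {Ω Ω' : Type*} [MeasurableSpace Ω] [MeasurableSpace Ω']
    (P : Measure Ω) (T : ℕ → Ω → ℕ) (Q : Measure Ω') (ω : ℕ → Ω' → ℝ) (β : ℝ) : ℝ :=
  sSup {h : ℝ | annealedFreeEnergy P T Q ω β h = 0}

end

end Pinning

/-! Averaging the Gaussian disorder gives a path with k contacts the weight exp(c k + b G_k), where
c = h + β²/2, b = β² and G_k (`pairEnergy`) sums ρ over the pairwise distances of the contacts.
Since ρ is summable and contacts are distinct integers, a block of k contacts interacts with
everything after it by at most X_k (`crossBound`), a sum of k tails of Σ|ρ|, so X_k = o(k). Up to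
factors exp(±b X_k) the model therefore factorizes over blocks of renewal epochs. Let B_k
(`blockWeight` with constant tilt 1) be the mean weight of k epochs.

The free energy exists by a Fekete argument with a sublinear error
(`exists_tendsto_of_almost_superadditive`), and it is nonnegative because a single jump costs only a
subexponential factor along n = 2^j. Put s = Σ ρ_n P(n ∈ τ), which is the limit of E G_k / k. If the
free energy vanishes, then exp(-b X_k) B_k ≤ 1 for every k: otherwise B_{qk}, even slightly damped,
would grow geometrically in q, while the damped series of partition functions converges. Jensen's
inequality and k → ∞ then give c ≤ -b s for every β (`le_of_freeEnergy_eq_zero`). Conversely, exp(b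
X_k) B_k ≤ 1 for a single k keeps all B_j bounded, and the free energy is nonpositive
(`freeEnergy_nonpos_of_blockWeight_le`); for c = -κ b with κ > s, expanding in b at a fixed large k
yields this condition for small b (`eventually_blockWeight_le`).

This determines the critical point up to o(β²), which is an asymptotic equivalence because 1 + 2s >
0 (`variance_constant_pos`). Indeed ρ_n = ⟨ξ, Uⁿ ξ⟩ for an isometry U, so with A = E[U^{T₁}] the
constant is the limit as t ↑ 1 of 2 Σ_j t^j ⟨ξ, A^j ξ⟩ - 1. For v = (1 - tA)⁻¹ ξ this expression is
‖v‖² - ‖tAv‖², at least the variance of U^{T₁} v, which is bounded below by a multiple of ‖Uξ - ξ‖²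
> 0, uniformly in t. -/

namespace Pinning

/-! ### Pair energies of epochs and their decoupling -/

/-- The sum of the first `k` gaps of the sequence `t`. -/
def epoch (t : ℕ → ℕ) (k : ℕ) : ℕ := ∑ i ∈ Finset.range k, t i

lemma epoch_add (t : ℕ → ℕ) (k l : ℕ) :
    epoch t (k + l) = epoch t k + epoch (fun i => t (k + i)) l :=
  Finset.sum_range_add _ _ _

lemma epoch_congr {t t' : ℕ → ℕ} {k : ℕ} (h : ∀ i < k, t i = t' i) : epoch t k = epoch t' k :=
  Finset.sum_congr rfl fun i hi => h i (Finset.mem_range.1 hi)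

lemma epoch_strictMono {t : ℕ → ℕ} (ht : ∀ i, 0 < t i) : StrictMono (epoch t) :=
  strictMono_nat_of_lt_succ fun n => by simp [epoch, Finset.sum_range_succ, ht n]

lemma le_epoch {t : ℕ → ℕ} (ht : ∀ i, 0 < t i) (k : ℕ) : k ≤ epoch t k :=
  (epoch_strictMono ht).le_apply

/-- The interaction energy of the first `k` epochs for the pair potential `r`. -/
noncomputable def pairEnergy (r : ℕ → ℝ) (k : ℕ) (t : ℕ → ℕ) : ℝ :=
  ∑ j ∈ Finset.range k, ∑ i ∈ Finset.range j, r (epoch t (j + 1) - epoch t (i + 1))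

/-- The interaction energy between the first `k` epochs and the following `l` ones. -/
noncomputable def crossEnergy (r : ℕ → ℝ) (k l : ℕ) (t : ℕ → ℕ) : ℝ :=
  ∑ j ∈ Finset.range l, ∑ i ∈ Finset.range k, r (epoch t (k + j + 1) - epoch t (i + 1))

lemma pairEnergy_congr (r : ℕ → ℝ) {t t' : ℕ → ℕ} {k : ℕ} (h : ∀ i < k, t i = t' i) :
    pairEnergy r k t = pairEnergy r k t' := by
  refine Finset.sum_congr rfl fun j hj => Finset.sum_congr rfl fun i hi => ?_
  rw [Finset.mem_range] at hi hj
  rw [epoch_congr fun a ha => h a (by omega), epoch_congr fun a ha => h a (by omega)]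

/-- Distances inside the second block depend only on its own gaps, so that block sees the same
energy functional of the shifted sequence. -/
lemma pairEnergy_add (r : ℕ → ℝ) (k l : ℕ) (t : ℕ → ℕ) :
    pairEnergy r (k + l) t =
      pairEnergy r k t + pairEnergy r l (fun i => t (k + i)) + crossEnergy r k l t := by
  rw [pairEnergy, Finset.sum_range_add, add_assoc, pairEnergy, pairEnergy, crossEnergy,
    ← Finset.sum_add_distrib]
  congr 1
  refine Finset.sum_congr rfl fun j _ => ?_
  rw [Finset.sum_range_add, add_comm]
  congr 1
  refine Finset.sum_congr rfl fun i _ => ?_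
  rw [add_assoc, add_assoc, epoch_add, epoch_add t k (i + 1), Nat.add_sub_add_left]

/-- The tail sums `∑_{m ≥ s} |r m|`. -/
noncomputable def tailSum (r : ℕ → ℝ) (s : ℕ) : ℝ := ∑' m, |r (m + s)|

/-- A bound for the interaction between a block of `k` epochs and all later epochs. -/
noncomputable def crossBound (r : ℕ → ℝ) (k : ℕ) : ℝ := ∑ s ∈ Finset.range k, tailSum r (s + 1)

lemma tailSum_nonneg (r : ℕ → ℝ) (s : ℕ) : 0 ≤ tailSum r s := tsum_nonneg fun _ => abs_nonneg _

lemma crossBound_nonneg (r : ℕ → ℝ) (k : ℕ) : 0 ≤ crossBound r k :=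
  Finset.sum_nonneg fun _ _ => tailSum_nonneg _ _

lemma crossBound_mono (r : ℕ → ℝ) : Monotone (crossBound r) :=
  monotone_nat_of_le_succ fun k => by
    rw [crossBound, crossBound, Finset.sum_range_succ]
    linarith [tailSum_nonneg r (k + 1)]

/-- The shifted tails tend to zero, hence so do their Cesàro means: decoupling a block of k epochs
costs o(k). If |r| is not summable, every tail has the default value 0. -/
lemma tendsto_crossBound_div (r : ℕ → ℝ) :
    Tendsto (fun k : ℕ => crossBound r k / k) atTop (𝓝 0) := by
  have h : Tendsto (fun s => tailSum r (s + 1)) atTop (𝓝 0) :=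
    (tendsto_sum_nat_add fun m => |r m|).comp (tendsto_add_atTop_nat 1)
  simpa [crossBound, div_eq_inv_mul] using h.cesaro

/-- Summing `|r|` over distinct arguments that are at least `s` gives at most `tailSum r s`. -/
lemma sum_abs_le_tailSum {r : ℕ → ℝ} (hr : Summable fun m => |r m|) {ι : Type*} (F : Finset ι)
    {f : ι → ℕ} (hf : Set.InjOn f F) {s : ℕ} (hs : ∀ i ∈ F, s ≤ f i) :
    ∑ i ∈ F, |r (f i)| ≤ tailSum r s := by
  have h1 : ∑ i ∈ F, |r (f i)| = ∑ m ∈ F.image (fun i => f i - s), |r (m + s)| := by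
    rw [Finset.sum_image]
    · exact Finset.sum_congr rfl fun i hi => by rw [Nat.sub_add_cancel (hs i hi)]
    · intro a ha b hb hab
      have := hs a ha
      have := hs b hb
      exact hf ha hb (by simp only at hab; omega)
  rw [h1]
  exact ((summable_nat_add_iff s).2 hr).sum_le_tsum _ fun _ _ => abs_nonneg _

/-- Gaps are at least 1, so epoch i + 1 of the first block is at distance at least k - i from all
later blocks' epochs, and these distances are distinct; its interaction is at most `tailSum r (k -
i)`. Nothing depends on `l`. -/
lemma abs_crossEnergy_le {r : ℕ → ℝ} (hr : Summable fun m => |r m|) {t : ℕ → ℕ}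
    (ht : ∀ i, 0 < t i) (k l : ℕ) : |crossEnergy r k l t| ≤ crossBound r k := by
  have hmono := epoch_strictMono ht
  rw [crossEnergy, Finset.sum_comm]
  have key : ∀ i ∈ Finset.range k,
      |∑ j ∈ Finset.range l, r (epoch t (k + j + 1) - epoch t (i + 1))| ≤
        tailSum r (k - 1 - i + 1) := by
    intro i hi
    rw [Finset.mem_range] at hi
    refine (Finset.abs_sum_le_sum_abs _ _).trans (sum_abs_le_tailSum hr _ ?_ ?_)
    · intro a _ b _ hab
      have h1 := hmono.monotone (show i + 1 ≤ k + a + 1 by omega)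
      have h2 := hmono.monotone (show i + 1 ≤ k + b + 1 by omega)
      have := hmono.injective (show epoch t (k + a + 1) = epoch t (k + b + 1) by
        simp only at hab; omega)
      omega
    · intro j _
      have h1 := epoch_add t (i + 1) (k + j - i)
      rw [show i + 1 + (k + j - i) = k + j + 1 by omega] at h1
      have h2 := le_epoch (fun a => ht (i + 1 + a)) (k + j - i)
      omega
  refine (Finset.abs_sum_le_sum_abs _ _).trans ((Finset.sum_le_sum key).trans ?_)
  rw [crossBound, Finset.sum_range_reflect (fun s => tailSum r (s + 1))]

lemma abs_pairEnergy_le {r : ℕ → ℝ} (hr : Summable fun m => |r m|) {t : ℕ → ℕ}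
    (ht : ∀ i, 0 < t i) (k : ℕ) : |pairEnergy r k t| ≤ k * tailSum r 0 := by
  have hmono := epoch_strictMono ht
  have key : ∀ j ∈ Finset.range k,
      |∑ i ∈ Finset.range j, r (epoch t (j + 1) - epoch t (i + 1))| ≤ tailSum r 0 := by
    intro j _
    refine (Finset.abs_sum_le_sum_abs _ _).trans
      (sum_abs_le_tailSum hr _ ?_ fun _ _ => Nat.zero_le _)
    intro a ha b hb hab
    simp only [Finset.coe_range, Set.mem_Iio] at ha hb
    have h1 := hmono.monotone (show a + 1 ≤ j + 1 by omega)
    have h2 := hmono.monotone (show b + 1 ≤ j + 1 by omega)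
    have := hmono.injective (show epoch t (a + 1) = epoch t (b + 1) by
      simp only at hab; omega)
    omega
  refine (Finset.abs_sum_le_sum_abs _ _).trans ((Finset.sum_le_sum key).trans ?_)
  simp

/-! ### Boltzmann weights -/

/-- The Boltzmann weight of the first `k` epochs. -/
noncomputable def weight (c b : ℝ) (r : ℕ → ℝ) (k : ℕ) (t : ℕ → ℕ) : ℝ :=
  Real.exp (c * k + b * pairEnergy r k t)

lemma weight_pos (c b : ℝ) (r : ℕ → ℝ) (k : ℕ) (t : ℕ → ℕ) : 0 < weight c b r k t :=
  Real.exp_pos _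

lemma weight_congr (c b : ℝ) (r : ℕ → ℝ) {t t' : ℕ → ℕ} {k : ℕ} (h : ∀ i < k, t i = t' i) :
    weight c b r k t = weight c b r k t' := by
  rw [weight, weight, pairEnergy_congr r h]

lemma weight_add (c b : ℝ) (r : ℕ → ℝ) (k l : ℕ) (t : ℕ → ℕ) :
    weight c b r (k + l) t = weight c b r k t * weight c b r l (fun i => t (k + i)) *
      Real.exp (b * crossEnergy r k l t) := by
  rw [weight, weight, weight, ← Real.exp_add, ← Real.exp_add, pairEnergy_add]
  congr 1
  push_cast
  ring

lemma weight_le {c b : ℝ} (hb : 0 ≤ b) {r : ℕ → ℝ} (hr : Summable fun m => |r m|) {t : ℕ → ℕ}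
    (ht : ∀ i, 0 < t i) (k : ℕ) : weight c b r k t ≤ Real.exp ((c + b * tailSum r 0) * k) := by
  refine Real.exp_le_exp.2 ?_
  have h := mul_le_mul_of_nonneg_left ((le_abs_self _).trans (abs_pairEnergy_le hr ht k)) hb
  linarith

lemma weight_one (c b : ℝ) (r : ℕ → ℝ) (t : ℕ → ℕ) : weight c b r 1 t = Real.exp c := by
  simp [weight, pairEnergy]

lemma measurable_epoch (k : ℕ) : Measurable fun t : ℕ → ℕ => epoch t k := by
  unfold epoch
  fun_prop

lemma measurable_pairEnergy (r : ℕ → ℝ) (k : ℕ) : Measurable (pairEnergy r k) := by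
  refine Finset.measurable_sum _ fun j _ => Finset.measurable_sum _ fun i _ => ?_
  exact (measurable_from_nat (f := r)).comp ((measurable_epoch _).sub (measurable_epoch _))

lemma measurable_weight (c b : ℝ) (r : ℕ → ℝ) (k : ℕ) : Measurable (weight c b r k) :=
  (((measurable_pairEnergy r k).const_mul b).const_add _).exp

/-- The indicator of the point `n`. -/
noncomputable def pointMass (n : ℕ) : ℕ → ℝ := ({n} : Set ℕ).indicator 1

lemma pointMass_mem_Icc (n m : ℕ) : pointMass n m ∈ Set.Icc (0 : ℝ) 1 := by
  by_cases h : m = n <;> simp [pointMass, h]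

/-- Decomposition of a functional of the contact set according to the number of epochs. -/
lemma sum_mul_pointMass_epoch {t : ℕ → ℕ} (ht : ∀ i, 0 < t i) {n : ℕ} (hn : 1 ≤ n)
    (f : ℕ → ℝ) :
    (∃ k, epoch t k = n ∧ 1 ≤ k ∧
      ∑ j ∈ Finset.Icc 1 n, f j * pointMass n (epoch t j) = f k) ∨
    ((∀ k, epoch t k ≠ n) ∧
      ∑ j ∈ Finset.Icc 1 n, f j * pointMass n (epoch t j) = 0) := by
  have hmono := epoch_strictMono ht
  by_cases h : ∃ k, epoch t k = n
  · obtain ⟨k, hk⟩ := h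
    have hk1 : 1 ≤ k := by
      by_contra h0
      have : k = 0 := by omega
      subst this
      simp [epoch] at hk
      omega
    refine Or.inl ⟨k, hk, hk1, ?_⟩
    rw [Finset.sum_eq_single k]
    · simp [pointMass, hk]
    · intro j _ hj
      have : epoch t j ≠ n := fun h => hj (hmono.injective (h.trans hk.symm))
      simp [pointMass, this]
    · intro hk'
      have := le_epoch ht k
      exact absurd (Finset.mem_Icc.2 ⟨hk1, by omega⟩) hk'
  · push Not at h
    refine Or.inr ⟨h, Finset.sum_eq_zero fun j _ => ?_⟩
    simp [pointMass, h j]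

/-! ### Independence of blocks and factorization up to the decoupling cost -/

section Blocks

variable {Ω : Type*} [MeasurableSpace Ω] {P : Measure Ω} {T : ℕ → Ω → ℕ}

lemma IsInterarrival.measurable_seq (hT : IsInterarrival P T) :
    Measurable fun x i => T i x := measurable_pi_iff.2 hT.measurable

/-- The expected Boltzmann weight of the first `k` epochs, tilted by a function `φ` of the
position of the `k`-th one. -/
noncomputable def blockWeight (P : Measure Ω) (T : ℕ → Ω → ℕ) (c b : ℝ) (r : ℕ → ℝ) (k : ℕ)
    (φ : ℕ → ℝ) : ℝ :=
  ∫ x, weight c b r k (fun i => T i x) * φ (epoch (fun i => T i x) k) ∂P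

lemma blockWeight_nonneg {c b : ℝ} {r : ℕ → ℝ} {k : ℕ} {φ : ℕ → ℝ} (hφ : ∀ n, 0 ≤ φ n) :
    0 ≤ blockWeight P T c b r k φ :=
  integral_nonneg fun _ => mul_nonneg (weight_pos _ _ _ _ _).le (hφ _)

lemma IsInterarrival.identDistrib_shift (hT : IsInterarrival P T) (k : ℕ) :
    IdentDistrib (fun x i => T (k + i) x) (fun x i => T i x) P P where
  aemeasurable_fst := (measurable_pi_iff.2 fun i => hT.measurable (k + i)).aemeasurable
  aemeasurable_snd := hT.measurable_seq.aemeasurable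
  map_eq := by
    have h : iIndepFun (fun i => T (k + i)) P := hT.indep.precomp (add_right_injective k)
    rw [h.map_fun_eq_infinitePi_map (fun i => hT.measurable _),
      hT.indep.map_fun_eq_infinitePi_map hT.measurable]
    congr 1
    funext i
    rw [(hT.identDistrib (k + i)).map_eq, (hT.identDistrib i).map_eq]

lemma IsInterarrival.integral_shift (hT : IsInterarrival P T) (k : ℕ) {f : (ℕ → ℕ) → ℝ}
    (hf : Measurable f) :
    ∫ x, f (fun i => T (k + i) x) ∂P = ∫ x, f (fun i => T i x) ∂P :=
  ((hT.identDistrib_shift k).comp hf).integral_eq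

/-- Functions of the first `k` gaps are independent of functions of the next `l` gaps. -/
lemma IsInterarrival.integral_mul_shift (hT : IsInterarrival P T) (k l : ℕ)
    {f g : (ℕ → ℕ) → ℝ} (hf : Measurable f) (hg : Measurable g)
    (hfk : ∀ t t' : ℕ → ℕ, (∀ i < k, t i = t' i) → f t = f t')
    (hgl : ∀ t t' : ℕ → ℕ, (∀ i < l, t i = t' i) → g t = g t') :
    ∫ x, f (fun i => T i x) * g (fun i => T (k + i) x) ∂P =
      (∫ x, f (fun i => T i x) ∂P) * ∫ x, g (fun i => T i x) ∂P := by
  classical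
  let ext₁ : (Finset.range k → ℕ) → ℕ → ℕ :=
    fun t i => if h : i ∈ Finset.range k then t ⟨i, h⟩ else 0
  let ext₂ : (Finset.Ico k (k + l) → ℕ) → ℕ → ℕ :=
    fun t i => if h : k + i ∈ Finset.Ico k (k + l) then t ⟨k + i, h⟩ else 0
  have hm₁ : Measurable ext₁ := by
    refine measurable_pi_iff.2 fun i => ?_
    by_cases h : i ∈ Finset.range k
    · simpa only [ext₁, h, dite_true] using measurable_pi_apply (⟨i, h⟩ : Finset.range k)
    · simp only [ext₁, h, dite_false]
      exact measurable_const
  have hm₂ : Measurable ext₂ := by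
    refine measurable_pi_iff.2 fun i => ?_
    by_cases h : k + i ∈ Finset.Ico k (k + l)
    · simpa only [ext₂, h, dite_true] using
        measurable_pi_apply (⟨k + i, h⟩ : Finset.Ico k (k + l))
    · simp only [ext₂, h, dite_false]
      exact measurable_const
  have hdisj : Disjoint (Finset.range k) (Finset.Ico k (k + l)) := by
    rw [Finset.disjoint_left]
    intro a ha hb
    simp only [Finset.mem_range, Finset.mem_Ico] at ha hb
    omega
  have hind := (hT.indep.indepFun_finset _ _ hdisj hT.measurable).comp
    (hf.comp hm₁) (hg.comp hm₂)
  have e₁ : ((f ∘ ext₁) ∘ fun a (i : Finset.range k) => T i a) = fun x => f (fun i => T i x) := by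
    funext x
    refine hfk _ _ fun i hi => ?_
    simp [ext₁, hi]
  have e₂ : ((g ∘ ext₂) ∘ fun a (i : Finset.Ico k (k + l)) => T i a) =
      fun x => g (fun i => T (k + i) x) := by
    funext x
    refine hgl _ _ fun i hi => ?_
    simp [ext₂, hi]
  rw [e₁, e₂] at hind
  rw [hind.integral_fun_mul_eq_mul_integral, hT.integral_shift k hg]
  · exact (hf.comp hT.measurable_seq).aestronglyMeasurable
  · exact (hg.comp (measurable_pi_iff.2 fun i => hT.measurable (k + i))).aestronglyMeasurable

lemma measurable_weight_mul_epoch (c b : ℝ) (r : ℕ → ℝ) (k : ℕ) (φ : ℕ → ℝ) :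
    Measurable fun t => weight c b r k t * φ (epoch t k) :=
  (measurable_weight c b r k).mul ((measurable_from_nat (f := φ)).comp (measurable_epoch k))

/-- The product of two block weights, as one expectation. -/
lemma blockWeight_mul_blockWeight (hT : IsInterarrival P T) (c b : ℝ) (r : ℕ → ℝ) (k l : ℕ)
    (φ ψ : ℕ → ℝ) :
    blockWeight P T c b r k φ * blockWeight P T c b r l ψ =
      ∫ x, (weight c b r k (fun i => T i x) * φ (epoch (fun i => T i x) k)) *
        (weight c b r l (fun i => T (k + i) x) * ψ (epoch (fun i => T (k + i) x) l)) ∂P := by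
  rw [hT.integral_mul_shift k l (measurable_weight_mul_epoch c b r k φ)
    (measurable_weight_mul_epoch c b r l ψ)]
  · rfl
  · intro t t' h
    rw [weight_congr c b r h, epoch_congr h]
  · intro t t' h
    rw [weight_congr c b r h, epoch_congr h]

variable [IsProbabilityMeasure P]

/-- The integrands in `blockWeight` are bounded and measurable. -/
lemma integrable_weight_mul (hT : IsInterarrival P T) {c b : ℝ} (hb : 0 ≤ b) {r : ℕ → ℝ}
    (hr : Summable fun m => |r m|) (k : ℕ) {ψ : (ℕ → ℕ) → ℝ} (hψ : Measurable ψ) {M : ℝ}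
    (hM : ∀ t, |ψ t| ≤ M) :
    Integrable (fun x => weight c b r k (fun i => T i x) * ψ (fun i => T i x)) P := by
  refine Integrable.of_bound
    (((measurable_weight c b r k).mul hψ).comp hT.measurable_seq).aestronglyMeasurable
    (Real.exp ((c + b * tailSum r 0) * k) * M) (ae_of_all _ fun x => ?_)
  rw [norm_mul, Real.norm_eq_abs, Real.norm_eq_abs, abs_of_pos (weight_pos _ _ _ _ _)]
  exact mul_le_mul (weight_le hb hr (fun i => hT.pos i x) k) (hM _) (abs_nonneg _)
    (Real.exp_pos _).le

lemma weight_add_le {c b : ℝ} (hb : 0 ≤ b) {r : ℕ → ℝ} (hr : Summable fun m => |r m|)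
    {t : ℕ → ℕ} (ht : ∀ i, 0 < t i) (k l : ℕ) :
    weight c b r (k + l) t ≤ Real.exp (b * crossBound r k) *
      (weight c b r k t * weight c b r l (fun i => t (k + i))) := by
  rw [weight_add, mul_comm (Real.exp _)]
  refine mul_le_mul_of_nonneg_left (Real.exp_le_exp.2 (mul_le_mul_of_nonneg_left
    ((le_abs_self _).trans (abs_crossEnergy_le hr ht k l)) hb)) ?_
  exact (mul_pos (weight_pos _ _ _ _ _) (weight_pos _ _ _ _ _)).le

lemma le_weight_add {c b : ℝ} (hb : 0 ≤ b) {r : ℕ → ℝ} (hr : Summable fun m => |r m|)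
    {t : ℕ → ℕ} (ht : ∀ i, 0 < t i) (k l : ℕ) :
    Real.exp (-(b * crossBound r k)) * (weight c b r k t * weight c b r l (fun i => t (k + i))) ≤
      weight c b r (k + l) t := by
  rw [weight_add, mul_comm (Real.exp _)]
  refine mul_le_mul_of_nonneg_left (Real.exp_le_exp.2 ?_)
    (mul_pos (weight_pos _ _ _ _ _) (weight_pos _ _ _ _ _)).le
  have h := mul_le_mul_of_nonneg_left
    ((neg_le_abs _).trans (abs_crossEnergy_le hr ht k l)) hb
  linarith

/-- Joint block weight of `k` epochs followed by `l` epochs. -/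
noncomputable def jointWeight (P : Measure Ω) (T : ℕ → Ω → ℕ) (c b : ℝ) (r : ℕ → ℝ) (k l : ℕ)
    (φ ψ : ℕ → ℝ) : ℝ :=
  ∫ x, weight c b r (k + l) (fun i => T i x) *
    (φ (epoch (fun i => T i x) k) * ψ (epoch (fun i => T (k + i) x) l)) ∂P

lemma measurable_joint (k l : ℕ) (φ ψ : ℕ → ℝ) :
    Measurable fun t : ℕ → ℕ => φ (epoch t k) * ψ (epoch (fun i => t (k + i)) l) := by
  refine ((measurable_from_nat (f := φ)).comp (measurable_epoch k)).mul
    ((measurable_from_nat (f := ψ)).comp ((measurable_epoch l).comp ?_))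
  exact measurable_pi_iff.2 fun i => measurable_pi_apply _

lemma integrable_joint (hT : IsInterarrival P T) {c b : ℝ} (hb : 0 ≤ b) {r : ℕ → ℝ}
    (hr : Summable fun m => |r m|) (k l : ℕ) {φ ψ : ℕ → ℝ} (hφ : ∀ n, φ n ∈ Set.Icc 0 1)
    (hψ : ∀ n, ψ n ∈ Set.Icc 0 1) :
    Integrable (fun x => weight c b r (k + l) (fun i => T i x) *
      (φ (epoch (fun i => T i x) k) * ψ (epoch (fun i => T (k + i) x) l))) P := by
  refine integrable_weight_mul hT hb hr (k + l) (measurable_joint k l φ ψ) (M := 1) fun t => ?_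
  have h1 := hφ (epoch t k)
  have h2 := hψ (epoch (fun i => t (k + i)) l)
  rw [abs_of_nonneg (mul_nonneg h1.1 h2.1)]
  exact mul_le_one₀ h1.2 h2.1 h2.2

lemma integrable_joint_mul (hT : IsInterarrival P T) {c b : ℝ} (hb : 0 ≤ b) {r : ℕ → ℝ}
    (hr : Summable fun m => |r m|) (k l : ℕ) {φ ψ : ℕ → ℝ} (hφ : ∀ n, φ n ∈ Set.Icc 0 1)
    (hψ : ∀ n, ψ n ∈ Set.Icc 0 1) :
    Integrable (fun x => (weight c b r k (fun i => T i x) * φ (epoch (fun i => T i x) k)) *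
        (weight c b r l (fun i => T (k + i) x) * ψ (epoch (fun i => T (k + i) x) l))) P := by
  have hsh : Measurable fun (t : ℕ → ℕ) i => t (k + i) :=
    measurable_pi_iff.2 fun i => measurable_pi_apply _
  -- The weight of the second block is bounded only along positive gaps, while a bound for all
  -- sequences is required; the truncation by `min` changes nothing on actual paths.
  have h := integrable_weight_mul hT (c := c) hb hr k
    (ψ := fun t => φ (epoch t k) * (ψ (epoch (fun i => t (k + i)) l) *
      min (weight c b r l (fun i => t (k + i))) (Real.exp ((c + b * tailSum r 0) * l))))
    (M := Real.exp ((c + b * tailSum r 0) * l)) ?_ ?_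
  · refine h.congr (ae_of_all _ fun x => ?_)
    have := weight_le hb hr (c := c) (fun i => hT.pos (k + i) x) l
    simp only [min_eq_left this]
    ring
  · exact ((measurable_from_nat (f := φ)).comp (measurable_epoch k)).mul
      (((measurable_from_nat (f := ψ)).comp ((measurable_epoch l).comp hsh)).mul
      (((measurable_weight c b r l).comp hsh).min measurable_const))
  · intro t
    have h1 := hφ (epoch t k)
    have h2 := hψ (epoch (fun i => t (k + i)) l)
    have h3 : 0 ≤ min (weight c b r l (fun i => t (k + i)))
      (Real.exp ((c + b * tailSum r 0) * l)) :=
      le_min (weight_pos _ _ _ _ _).le (Real.exp_pos _).le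
    rw [abs_of_nonneg (mul_nonneg h1.1 (mul_nonneg h2.1 h3))]
    calc _ ≤ 1 * (1 * Real.exp ((c + b * tailSum r 0) * l)) :=
          mul_le_mul h1.2 (mul_le_mul h2.2 (min_le_right _ _) h3 zero_le_one)
            (mul_nonneg h2.1 h3) zero_le_one
      _ = _ := by ring

lemma jointWeight_le (hT : IsInterarrival P T) {c b : ℝ} (hb : 0 ≤ b) {r : ℕ → ℝ}
    (hr : Summable fun m => |r m|) (k l : ℕ) {φ ψ : ℕ → ℝ} (hφ : ∀ n, φ n ∈ Set.Icc 0 1)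
    (hψ : ∀ n, ψ n ∈ Set.Icc 0 1) :
    jointWeight P T c b r k l φ ψ ≤ Real.exp (b * crossBound r k) *
      (blockWeight P T c b r k φ * blockWeight P T c b r l ψ) := by
  rw [blockWeight_mul_blockWeight hT, ← integral_const_mul, jointWeight]
  refine integral_mono (integrable_joint hT hb hr k l hφ hψ)
    ((integrable_joint_mul hT hb hr k l hφ hψ).const_mul _) fun x => ?_
  have h := mul_le_mul_of_nonneg_right (weight_add_le hb hr (c := c) (fun i => hT.pos i x) k l)
    (mul_nonneg (hφ (epoch (fun i => T i x) k)).1 (hψ (epoch (fun i => T (k + i) x) l)).1)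
  refine h.trans_eq ?_
  ring

lemma le_jointWeight (hT : IsInterarrival P T) {c b : ℝ} (hb : 0 ≤ b) {r : ℕ → ℝ}
    (hr : Summable fun m => |r m|) (k l : ℕ) {φ ψ : ℕ → ℝ} (hφ : ∀ n, φ n ∈ Set.Icc 0 1)
    (hψ : ∀ n, ψ n ∈ Set.Icc 0 1) :
    Real.exp (-(b * crossBound r k)) *
      (blockWeight P T c b r k φ * blockWeight P T c b r l ψ) ≤ jointWeight P T c b r k l φ ψ := by
  rw [blockWeight_mul_blockWeight hT, ← integral_const_mul, jointWeight]
  refine integral_mono ((integrable_joint_mul hT hb hr k l hφ hψ).const_mul _)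
    (integrable_joint hT hb hr k l hφ hψ) fun x => ?_
  have h := mul_le_mul_of_nonneg_right (le_weight_add hb hr (c := c) (fun i => hT.pos i x) k l)
    (mul_nonneg (hφ (epoch (fun i => T i x) k)).1 (hψ (epoch (fun i => T (k + i) x) l)).1)
  refine Eq.trans_le ?_ h
  ring

end Blocks

/-! ### Gaussian averages of the disorder -/

section Disorder

variable {Ω' : Type*} [MeasurableSpace Ω'] {Q : Measure Ω'} {ω : ℕ → Ω' → ℝ}

lemma IsStationaryGaussianDisorder.memLp_two (hω : IsStationaryGaussianDisorder Q ω) (i : ℕ) :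
    MemLp (ω i) 2 Q := (hω.gaussian.hasGaussianLaw_eval i).memLp_two

lemma IsStationaryGaussianDisorder.integral_eq_zero (hω : IsStationaryGaussianDisorder Q ω)
    (i : ℕ) : ∫ y, ω i y ∂Q = 0 := by
  have h := ((hω.stationary i).comp (measurable_pi_apply 0)).integral_eq
  simp only [Function.comp_def, zero_add] at h
  rw [h, hω.mean_zero]

lemma IsStationaryGaussianDisorder.integral_mul (hω : IsStationaryGaussianDisorder Q ω)
    (i m : ℕ) : ∫ y, ω i y * ω (i + m) y ∂Q = ∫ y, ω 0 y * ω m y ∂Q := by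
  have h := ((hω.stationary i).comp
    (u := fun w : ℕ → ℝ => w 0 * w m) (by fun_prop)).integral_eq
  simpa only [Function.comp_def, zero_add, add_comm m i] using h

variable [IsProbabilityMeasure Q]

lemma IsStationaryGaussianDisorder.correlation_eq (hω : IsStationaryGaussianDisorder Q ω)
    (m : ℕ) : correlation Q ω m = ∫ y, ω 0 y * ω m y ∂Q := by
  rw [correlation, covariance_eq_sub (hω.memLp_two 0) (hω.memLp_two m), hω.mean_zero]
  simp

lemma IsStationaryGaussianDisorder.covariance_eq (hω : IsStationaryGaussianDisorder Q ω)
    (i m : ℕ) : covariance (ω i) (ω (i + m)) Q = correlation Q ω m := by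
  rw [covariance_eq_sub (hω.memLp_two _) (hω.memLp_two _), hω.correlation_eq, ← hω.integral_mul i,
    hω.integral_eq_zero i]
  simp

lemma IsStationaryGaussianDisorder.correlation_zero (hω : IsStationaryGaussianDisorder Q ω) :
    correlation Q ω 0 = 1 := by
  rw [hω.correlation_eq, ← hω.second_moment]
  simp only [sq]

/-- A finite sum of the disorder variables is a centred Gaussian, and this is its moment generating
function at β. -/
lemma IsStationaryGaussianDisorder.integral_exp_sum (hω : IsStationaryGaussianDisorder Q ω)
    (β h : ℝ) (A : Finset ℕ) :
    ∫ y, Real.exp (∑ k ∈ A, (β * ω k y + h)) ∂Q =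
      Real.exp (h * A.card + β ^ 2 / 2 * ∑ i ∈ A, ∑ j ∈ A, covariance (ω i) (ω j) Q) := by
  have hg : HasGaussianLaw (fun y => ∑ k ∈ A, ω k y) Q := hω.gaussian.hasGaussianLaw_fun_sum
  have hmean : ∫ y, ∑ k ∈ A, ω k y ∂Q = 0 := by
    rw [integral_finsetSum _ fun k _ => (hω.memLp_two k).integrable (by norm_num)]
    exact Finset.sum_eq_zero fun k _ => hω.integral_eq_zero k
  have hmgf := mgf_gaussianReal hg.map_eq_gaussianReal β
  rw [hmean, variance_fun_sum' fun k _ => hω.memLp_two k, Real.coe_toNNReal, zero_mul, zero_add,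
    mgf] at hmgf
  · have e : ∀ y, Real.exp (∑ k ∈ A, (β * ω k y + h)) =
        Real.exp (h * A.card) * Real.exp (β * ∑ k ∈ A, ω k y) := by
      intro y
      rw [← Real.exp_add, Finset.sum_add_distrib, ← Finset.mul_sum]
      simp only [Finset.sum_const, nsmul_eq_mul]
      congr 1
      ring
    simp_rw [e]
    rw [integral_const_mul, hmgf, ← Real.exp_add]
    congr 1
    ring
  · rw [← variance_fun_sum' fun k _ => hω.memLp_two k]
    exact variance_nonneg _ _

/-- The variance of the disorder summed over the first `k` epochs. -/
lemma IsStationaryGaussianDisorder.sum_covariance_epoch (hω : IsStationaryGaussianDisorder Q ω)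
    {t : ℕ → ℕ} (ht : ∀ i, 0 < t i) (k : ℕ) :
    ∑ i ∈ Finset.range k, ∑ j ∈ Finset.range k,
      covariance (ω (epoch t (i + 1))) (ω (epoch t (j + 1))) Q =
        k + 2 * pairEnergy (correlation Q ω) k t := by
  induction k with
  | zero => simp [pairEnergy]
  | succ k ih =>
    have hc : ∀ i ∈ Finset.range k, covariance (ω (epoch t (i + 1))) (ω (epoch t (k + 1))) Q =
        correlation Q ω (epoch t (k + 1) - epoch t (i + 1)) := by
      intro i hi
      rw [Finset.mem_range] at hi
      have := (epoch_strictMono ht).monotone (show i + 1 ≤ k + 1 by omega)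
      rw [← hω.covariance_eq (epoch t (i + 1)), Nat.add_sub_cancel' this]
    have hd : covariance (ω (epoch t (k + 1))) (ω (epoch t (k + 1))) Q = 1 := by
      rw [← hω.correlation_zero, ← hω.covariance_eq (epoch t (k + 1)), add_zero]
    rw [Finset.sum_range_succ]
    simp_rw [Finset.sum_range_succ _ k]
    rw [Finset.sum_add_distrib, ih, hd, Finset.sum_congr rfl hc]
    rw [Finset.sum_congr rfl fun i hi => (covariance_comm _ _).trans (hc i hi)]
    rw [pairEnergy, pairEnergy, Finset.sum_range_succ]
    push_cast
    ring

end Disorder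

/-! ### Contact sets of the renewal -/

section Renewal

variable {Ω : Type*} [MeasurableSpace Ω] {P : Measure Ω} {T : ℕ → Ω → ℕ}

lemma measurableSet_renewalEvent (hT : IsInterarrival P T) (n : ℕ) :
    MeasurableSet (renewalEvent T n) := by
  have : renewalEvent T n = ⋃ k, renewalTime T k ⁻¹' {n} := by
    ext x
    simp [renewalEvent]
  rw [this]
  refine MeasurableSet.iUnion fun k => (measurableSet_singleton n).preimage ?_
  exact Finset.measurable_sum _ fun i _ => hT.measurable i

open Classical in
/-- The set of contacts in `[1, n]`. -/
noncomputable def contactSet (T : ℕ → Ω → ℕ) (n : ℕ) (x : Ω) : Finset ℕ :=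
  (Finset.Icc 1 n).filter fun m => x ∈ renewalEvent T m

omit [MeasurableSpace Ω] in
lemma sum_mul_contact (f : ℕ → ℝ) (n : ℕ) (x : Ω) :
    ∑ k ∈ Finset.Icc 1 n, f k * contact T k x = ∑ k ∈ contactSet T n x, f k := by
  classical
  rw [contactSet, Finset.sum_filter]
  refine Finset.sum_congr rfl fun k _ => ?_
  by_cases h : x ∈ renewalEvent T k <;> simp [contact, h]

lemma measurableSet_contactSet_eq (hT : IsInterarrival P T) (n : ℕ) (A : Finset ℕ) :
    MeasurableSet {x | contactSet T n x = A} := by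
  have : {x | contactSet T n x = A} =
      ⋂ m, {x | (m ∈ Finset.Icc 1 n ∧ x ∈ renewalEvent T m) ↔ m ∈ A} := by
    ext x
    simp [contactSet, Finset.ext_iff]
  rw [this]
  exact MeasurableSet.iInter fun m =>
    measurableSet_setOfPred.2 ((measurable_const.and
      (measurable_mem.2 (measurableSet_renewalEvent hT m))).iff measurable_const)

/-- The contact set in [1, n] takes finitely many values. The disorder average can thus be taken
term by term in a finite sum, without Fubini on the product space. -/
lemma integral_comp_contactSet [IsFiniteMeasure P] (hT : IsInterarrival P T) (n : ℕ)
    (Ψ : Finset ℕ → ℝ) :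
    ∫ x, Ψ (contactSet T n x) ∂P =
      ∑ A ∈ (Finset.Icc 1 n).powerset, P.real {x | contactSet T n x = A} * Ψ A := by
  classical
  have e : ∀ x, Ψ (contactSet T n x) = ∑ A ∈ (Finset.Icc 1 n).powerset,
      {x | contactSet T n x = A}.indicator (fun _ => Ψ A) x := by
    intro x
    rw [Finset.sum_eq_single (contactSet T n x)]
    · simp
    · intro A _ hA
      simp [hA.symm]
    · intro h
      exact absurd (Finset.mem_powerset.2 (Finset.filter_subset _ _)) h
  simp_rw [e]
  rw [integral_finsetSum]
  · refine Finset.sum_congr rfl fun A _ => ?_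
    rw [integral_indicator_const _ (measurableSet_contactSet_eq hT n A), smul_eq_mul]
  · intro A _
    exact (integrable_const _).indicator (measurableSet_contactSet_eq hT n A)

omit [MeasurableSpace Ω] in
lemma mem_renewalEvent_iff {n : ℕ} {x : Ω} :
    x ∈ renewalEvent T n ↔ ∃ k, epoch (fun i => T i x) k = n := Iff.rfl

lemma contactSet_of_epoch_eq (hT : IsInterarrival P T) {n k : ℕ} {x : Ω}
    (h : epoch (fun i => T i x) k = n) :
    contactSet T n x = (Finset.range k).image fun i => epoch (fun i => T i x) (i + 1) := by
  have hmono := epoch_strictMono fun i => hT.pos i x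
  ext m
  simp only [contactSet, Finset.mem_filter, Finset.mem_Icc, Finset.mem_image, Finset.mem_range,
    mem_renewalEvent_iff]
  constructor
  · rintro ⟨⟨h1, h2⟩, j, rfl⟩
    rw [← h, hmono.le_iff_le] at h2
    cases j with
    | zero => simp [epoch] at h1
    | succ j => exact ⟨j, h2, rfl⟩
  · rintro ⟨i, hi, rfl⟩
    refine ⟨⟨?_, ?_⟩, i + 1, rfl⟩
    · exact le_trans (by omega) (le_epoch (fun i => hT.pos i x) (i + 1))
    · rw [← h, hmono.le_iff_le]
      omega

end Renewal

/-! ### The annealed model as a renewal with pair interaction -/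

section Annealed

variable {Ω Ω' : Type*} [MeasurableSpace Ω] [MeasurableSpace Ω'] {P : Measure Ω}
  [IsProbabilityMeasure P] {Q : Measure Ω'} [IsProbabilityMeasure Q] {T : ℕ → Ω → ℕ}
  {ω : ℕ → Ω' → ℝ}

lemma quenchedPartition_eq_sum (hT : IsInterarrival P T) (w : ℕ → ℝ) (n : ℕ) (hn : 1 ≤ n)
    (β h : ℝ) :
    quenchedPartition P T w n β h =
      ∑ A ∈ (Finset.Icc 1 n).powerset, P.real {x | contactSet T n x = A} *
        (Real.exp (∑ k ∈ A, (β * w k + h)) * ({A | n ∈ A} : Set (Finset ℕ)).indicator 1 A) := by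
  rw [quenchedPartition, ← integral_comp_contactSet hT n
    fun A => Real.exp (∑ k ∈ A, (β * w k + h)) * ({A | n ∈ A} : Set (Finset ℕ)).indicator 1 A]
  refine integral_congr_ae (ae_of_all _ fun x => ?_)
  simp only
  rw [sum_mul_contact]
  congr 1
  by_cases h : x ∈ renewalEvent T n <;> simp [contact, h, contactSet, hn]

/-- The annealed partition function, decomposed according to the number of contacts. -/
lemma annealedPartition_eq_sum (hT : IsInterarrival P T) (hω : IsStationaryGaussianDisorder Q ω)
    (hρ : Summable fun n => |correlation Q ω n|) {n : ℕ} (hn : 1 ≤ n) (β h : ℝ) :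
    annealedPartition P T Q ω n β h =
      ∑ k ∈ Finset.Icc 1 n,
        blockWeight P T (h + β ^ 2 / 2) (β ^ 2) (correlation Q ω) k (pointMass n) := by
  rw [annealedPartition]
  simp_rw [quenchedPartition_eq_sum hT _ n hn]
  have hint : ∀ A : Finset ℕ, Integrable (fun y => Real.exp (∑ k ∈ A, (β * ω k y + h))) Q := by
    intro A
    -- A non-integrable function has Bochner integral 0, so the positive value of the Gaussian
    -- formula already gives integrability.
    refine Integrable.of_integral_ne_zero ?_
    rw [hω.integral_exp_sum]
    exact (Real.exp_pos _).ne'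
  rw [integral_finsetSum _ fun A _ => ((hint A).mul_const _).const_mul _]
  simp_rw [integral_const_mul, integral_mul_const, hω.integral_exp_sum]
  rw [← integral_comp_contactSet hT n fun A => Real.exp (h * A.card +
      β ^ 2 / 2 * ∑ i ∈ A, ∑ j ∈ A, covariance (ω i) (ω j) Q) *
        ({A | n ∈ A} : Set (Finset ℕ)).indicator 1 A]
  simp_rw [blockWeight]
  rw [← integral_finsetSum _ fun k _ => integrable_weight_mul hT (sq_nonneg β) hρ k
    (ψ := fun t => pointMass n (epoch t k))
    ((measurable_from_nat (f := pointMass n)).comp (measurable_epoch k)) (M := 1) fun t => by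
      have h := pointMass_mem_Icc n (epoch t k)
      rw [abs_of_nonneg h.1]
      exact h.2]
  refine integral_congr_ae (ae_of_all _ fun x => ?_)
  simp only
  rcases sum_mul_pointMass_epoch (fun i => hT.pos i x) hn (fun k => weight (h + β ^ 2 / 2) (β ^ 2)
    (correlation Q ω) k fun i => T i x) with ⟨k, hk, hk1, e⟩ | ⟨hk, e⟩
  · rw [e]
    have hmem : n ∈ contactSet T n x := by
      simp only [contactSet, Finset.mem_filter, Finset.mem_Icc]
      exact ⟨⟨hn, le_rfl⟩, k, hk⟩
    have hinj : Function.Injective fun i => epoch (fun i => T i x) (i + 1) := fun a b hab => by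
      have := (epoch_strictMono fun i => hT.pos i x).injective hab
      omega
    rw [Set.indicator_of_mem (by exact hmem), contactSet_of_epoch_eq hT hk,
      Finset.card_image_of_injective _ hinj, Finset.card_range]
    simp_rw [Finset.sum_image hinj.injOn]
    rw [hω.sum_covariance_epoch (fun i => hT.pos i x), weight, Pi.one_apply, mul_one]
    congr 1
    ring
  · rw [e, Set.indicator_of_notMem, mul_zero]
    simp only [contactSet, Set.mem_ofPred_eq, Finset.mem_filter, mem_renewalEvent_iff]
    rintro ⟨-, k, hk'⟩
    exact hk k hk'

end Annealed

/-! ### Existence and nonnegativity of the free energy -/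

/-- Fekete's lemma for superadditive sequences with a sublinear error depending on the first
block only. -/
lemma exists_tendsto_of_almost_superadditive {a e : ℕ → ℝ} {D : ℝ} (he : ∀ m, 0 ≤ e m)
    (he' : Tendsto (fun m : ℕ => e m / m) atTop (𝓝 0)) (hD : ∀ n, 1 ≤ n → a n ≤ D * n)
    (ha : ∀ m n, 1 ≤ m → 1 ≤ n → a m + a n - e m ≤ a (m + n)) :
    ∃ F, Tendsto (fun n : ℕ => a n / n) atTop (𝓝 F) := by
  -- The limit is the supremum of these slopes: with the error deducted, each of them is an
  -- asymptotic lower bound.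
  let S : Set ℝ := (fun m : ℕ => (a m - e m) / m) '' Set.Ici 1
  have hS : BddAbove S := by
    refine ⟨D, ?_⟩
    rintro _ ⟨m, hm, rfl⟩
    have hm' : (0 : ℝ) < m := Nat.cast_pos.2 hm
    simp only
    rw [div_le_iff₀ hm']
    linarith [hD m hm, he m]
  have hne : S.Nonempty := ⟨_, 1, Set.mem_Ici.2 le_rfl, rfl⟩
  -- Peel off blocks of length m from the front. Each pays `e m`, already deducted in the slope, and
  -- the last piece, of length at most m, costs a constant.
  have hlow : ∀ m : ℕ, 1 ≤ m → ∃ C : ℝ, ∀ n : ℕ, 1 ≤ n → (a m - e m) / m * n - C ≤ a n := by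
    intro m hm
    set y := (a m - e m) / m with hy
    have hm' : (0 : ℝ) < m := Nat.cast_pos.2 hm
    have hym : y * m = a m - e m := by rw [hy, div_mul_cancel₀ _ hm'.ne']
    refine ⟨∑ i ∈ Finset.range (m + 1), |a i - y * i|, fun n => ?_⟩
    induction n using Nat.strong_induction_on with
    | _ n ih =>
      intro hn
      rcases le_or_gt n m with h | h
      · have h1 := Finset.single_le_sum (f := fun i : ℕ => |a i - y * i|)
          (fun i _ => abs_nonneg _) (Finset.mem_range.2 (show n < m + 1 by omega))
        have h2 := neg_abs_le (a n - y * n)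
        linarith
      · have h1 := ih (n - m) (by omega) (by omega)
        have h2 := ha m (n - m) hm (by omega)
        rw [Nat.add_sub_cancel' h.le] at h2
        rw [Nat.cast_sub h.le] at h1
        linarith [mul_sub y (n : ℝ) m]
  refine ⟨sSup S, tendsto_order.2 ⟨fun z hz => ?_, fun z hz => ?_⟩⟩
  · obtain ⟨_, ⟨m, hm, rfl⟩, hzm⟩ := exists_lt_of_lt_csSup hne hz
    obtain ⟨C, hC⟩ := hlow m hm
    have h1 : Tendsto (fun n : ℕ => (a m - e m) / m - C / n) atTop (𝓝 ((a m - e m) / m - 0)) :=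
      tendsto_const_nhds.sub (tendsto_const_div_atTop_nhds_zero_nat C)
    rw [sub_zero] at h1
    filter_upwards [h1.eventually_const_lt hzm, eventually_ge_atTop 1] with n hn hn1
    have hn' : (0 : ℝ) < n := Nat.cast_pos.2 hn1
    refine hn.trans_le ?_
    rw [le_div_iff₀ hn', sub_mul, div_mul_cancel₀ _ hn'.ne']
    exact hC n hn1
  · filter_upwards [he'.eventually_lt_const (sub_pos.2 hz), eventually_ge_atTop 1] with n hn hn1
    have h1 : (a n - e n) / n ≤ sSup S := le_csSup hS ⟨n, hn1, rfl⟩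
    rw [sub_div] at h1
    linarith

section

variable {Ω : Type*} [MeasurableSpace Ω] {P : Measure Ω} {T : ℕ → Ω → ℕ}

/-- The partition function of a renewal of length `n` with pair interaction `r`. -/
noncomputable def pairPartition (P : Measure Ω) (T : ℕ → Ω → ℕ) (c b : ℝ) (r : ℕ → ℝ)
    (n : ℕ) : ℝ :=
  ∑ k ∈ Finset.Icc 1 n, blockWeight P T c b r k (pointMass n)

lemma blockWeight_le_pairPartition {c b : ℝ} {r : ℕ → ℝ} {k n : ℕ} (hk : k ∈ Finset.Icc 1 n) :
    blockWeight P T c b r k (pointMass n) ≤ pairPartition P T c b r n :=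
  Finset.single_le_sum (f := fun k => blockWeight P T c b r k (pointMass n))
    (fun _ _ => blockWeight_nonneg fun m => (pointMass_mem_Icc n m).1) hk

lemma blockWeight_one_pointMass (hT : IsInterarrival P T) (c b : ℝ) (r : ℕ → ℝ) (n : ℕ) :
    blockWeight P T c b r 1 (pointMass n) = Real.exp c * stepLaw P T n := by
  have h : ∀ x, pointMass n (epoch (fun i => T i x) 1) = {x | T 0 x = n}.indicator 1 x := by
    intro x
    by_cases h : T 0 x = n <;> simp [pointMass, epoch, h]
  simp_rw [blockWeight, weight_one, h]
  rw [integral_const_mul, integral_indicator_one, stepLaw]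
  exact (measurableSet_singleton n).preimage (hT.measurable 0)

lemma le_pairPartition (hT : IsInterarrival P T) (c b : ℝ) (r : ℕ → ℝ) {n : ℕ} (hn : 1 ≤ n) :
    Real.exp c * stepLaw P T n ≤ pairPartition P T c b r n := by
  rw [← blockWeight_one_pointMass hT c b r]
  exact blockWeight_le_pairPartition (Finset.mem_Icc.2 ⟨le_rfl, hn⟩)

variable [IsProbabilityMeasure P]

lemma integrable_weight_mul_comp_epoch (hT : IsInterarrival P T) {c b : ℝ} (hb : 0 ≤ b)
    {r : ℕ → ℝ} (hr : Summable fun m => |r m|) (k : ℕ) {φ : ℕ → ℝ}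
    (hφ : ∀ n, φ n ∈ Set.Icc 0 1) :
    Integrable (fun x => weight c b r k (fun i => T i x) * φ (epoch (fun i => T i x) k)) P :=
  integrable_weight_mul hT hb hr k (ψ := fun t => φ (epoch t k))
    ((measurable_from_nat (f := φ)).comp (measurable_epoch k)) (M := 1) fun t => by
      rw [abs_of_nonneg (hφ _).1]
      exact (hφ _).2

lemma pairPartition_eq_integral (hT : IsInterarrival P T) {c b : ℝ} (hb : 0 ≤ b)
    {r : ℕ → ℝ} (hr : Summable fun m => |r m|) (n : ℕ) :
    pairPartition P T c b r n = ∫ x, ∑ k ∈ Finset.Icc 1 n,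
      weight c b r k (fun i => T i x) * pointMass n (epoch (fun i => T i x) k) ∂P := by
  rw [integral_finsetSum _ fun k _ =>
    integrable_weight_mul_comp_epoch hT hb hr k (pointMass_mem_Icc n)]
  rfl

lemma pairPartition_le (hT : IsInterarrival P T) {c b : ℝ} (hb : 0 ≤ b)
    {r : ℕ → ℝ} (hr : Summable fun m => |r m|) {n : ℕ} (hn : 1 ≤ n) :
    pairPartition P T c b r n ≤ Real.exp (|c + b * tailSum r 0| * n) := by
  rw [pairPartition_eq_integral hT hb hr]
  refine (integral_mono (g := fun _ => Real.exp (|c + b * tailSum r 0| * n)) ?_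
    (integrable_const _) fun x => ?_).trans_eq (by simp)
  · exact integrable_finsetSum _ fun k _ =>
      integrable_weight_mul_comp_epoch hT hb hr k (pointMass_mem_Icc n)
  · have hpos : ∀ i, 0 < T i x := fun i => hT.pos i x
    simp only
    rcases sum_mul_pointMass_epoch hpos hn (fun k => weight c b r k fun i => T i x) with
      ⟨k, hk, hk1, e⟩ | ⟨hk, e⟩
    · rw [e]
      refine (weight_le hb hr hpos k).trans (Real.exp_le_exp.2 ?_)
      have : (k : ℝ) ≤ n := by
        rw [← hk]
        exact_mod_cast le_epoch hpos k
      exact mul_le_mul (le_abs_self _) this (by positivity) (abs_nonneg _)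
    · rw [e]
      positivity

/-- Almost superadditivity of the partition function. -/
lemma pairPartition_mul_le (hT : IsInterarrival P T) {c b : ℝ} (hb : 0 ≤ b)
    {r : ℕ → ℝ} (hr : Summable fun m => |r m|) {m n : ℕ} (hm : 1 ≤ m) (hn : 1 ≤ n) :
    Real.exp (-(b * crossBound r m)) * (pairPartition P T c b r m * pairPartition P T c b r n) ≤
      pairPartition P T c b r (m + n) := by
  have h1 : Real.exp (-(b * crossBound r m)) *
      (pairPartition P T c b r m * pairPartition P T c b r n) ≤
      ∑ k ∈ Finset.Icc 1 m, ∑ l ∈ Finset.Icc 1 n,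
        jointWeight P T c b r k l (pointMass m) (pointMass n) := by
    rw [pairPartition, pairPartition, Finset.sum_mul_sum, Finset.mul_sum]
    refine Finset.sum_le_sum fun k hk => ?_
    rw [Finset.mul_sum]
    refine Finset.sum_le_sum fun l _ => ?_
    refine le_trans ?_ (le_jointWeight hT hb hr k l (pointMass_mem_Icc m) (pointMass_mem_Icc n))
    -- Length m holds at most m epochs, so the cost for k epochs is at most the cost for m, which is
    -- uniform in k.
    refine mul_le_mul_of_nonneg_right (Real.exp_le_exp.2 (neg_le_neg
      (mul_le_mul_of_nonneg_left (crossBound_mono r (Finset.mem_Icc.1 hk).2) hb))) ?_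
    exact mul_nonneg (blockWeight_nonneg fun _ => (pointMass_mem_Icc _ _).1)
      (blockWeight_nonneg fun _ => (pointMass_mem_Icc _ _).1)
  refine h1.trans ?_
  have hint : ∀ k l, Integrable _ P := fun k l =>
    integrable_joint hT (c := c) hb hr k l (pointMass_mem_Icc m) (pointMass_mem_Icc n)
  rw [pairPartition_eq_integral hT hb hr]
  have h2 : ∑ k ∈ Finset.Icc 1 m, ∑ l ∈ Finset.Icc 1 n,
        jointWeight P T c b r k l (pointMass m) (pointMass n) =
      ∫ x, ∑ k ∈ Finset.Icc 1 m, ∑ l ∈ Finset.Icc 1 n, weight c b r (k + l) (fun i => T i x) *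
        (pointMass m (epoch (fun i => T i x) k) *
          pointMass n (epoch (fun i => T (k + i) x) l)) ∂P := by
    rw [integral_finsetSum _ fun k _ => integrable_finsetSum _ fun l _ => hint k l]
    refine Finset.sum_congr rfl fun k _ => ?_
    rw [integral_finsetSum _ fun l _ => hint k l]
    rfl
  rw [h2]
  refine integral_mono (integrable_finsetSum _ fun k _ => integrable_finsetSum _ fun l _ =>
    hint k l) (integrable_finsetSum _ fun k _ =>
      integrable_weight_mul_comp_epoch hT hb hr k (pointMass_mem_Icc _)) fun x => ?_
  simp only
  have hpos : ∀ i, 0 < T i x := fun i => hT.pos i x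
  have hnn : 0 ≤ ∑ k ∈ Finset.Icc 1 (m + n),
      weight c b r k (fun i => T i x) * pointMass (m + n) (epoch (fun i => T i x) k) :=
    Finset.sum_nonneg fun k _ => mul_nonneg (weight_pos _ _ _ _ _).le (pointMass_mem_Icc _ _).1
  have e1 : ∑ k ∈ Finset.Icc 1 m, ∑ l ∈ Finset.Icc 1 n, weight c b r (k + l) (fun i => T i x) *
        (pointMass m (epoch (fun i => T i x) k) * pointMass n (epoch (fun i => T (k + i) x) l)) =
      ∑ k ∈ Finset.Icc 1 m, (∑ l ∈ Finset.Icc 1 n, weight c b r (k + l) (fun i => T i x) *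
        pointMass n (epoch (fun i => T (k + i) x) l)) *
          pointMass m (epoch (fun i => T i x) k) := by
    refine Finset.sum_congr rfl fun k _ => ?_
    rw [Finset.sum_mul]
    exact Finset.sum_congr rfl fun l _ => by ring
  rw [e1]
  -- On a fixed path at most one k hits m, and then at most one l covers the next n sites; the
  -- surviving term appears in the sum for m + n at index k + l.
  rcases sum_mul_pointMass_epoch hpos hm (fun k => ∑ l ∈ Finset.Icc 1 n,
      weight c b r (k + l) (fun i => T i x) * pointMass n (epoch (fun i => T (k + i) x) l)) with
    ⟨k, hk, hk1, e⟩ | ⟨hk, e⟩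
  · rw [e]
    rcases sum_mul_pointMass_epoch (fun i => hpos (k + i)) hn
      (fun l => weight c b r (k + l) fun i => T i x) with ⟨l, hl, hl1, e'⟩ | ⟨hl, e'⟩
    · rw [e']
      have hkl : epoch (fun i => T i x) (k + l) = m + n := by
        rw [epoch_add, hk, hl]
      rcases sum_mul_pointMass_epoch hpos (show 1 ≤ m + n by omega)
        (fun l => weight c b r l fun i => T i x) with ⟨j, hj, hj1, e''⟩ | ⟨hj, -⟩
      · rw [e'', (epoch_strictMono hpos).injective (hkl.trans hj.symm)]
      · exact absurd hkl (hj _)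
    · rw [e']
      exact hnn
  · rw [e]
    exact hnn

lemma exists_tendsto_log_pairPartition (hT : IsInterarrival P T)
    (hK : ∀ n, 1 ≤ n → 0 < stepLaw P T n) {c b : ℝ} (hb : 0 ≤ b)
    {r : ℕ → ℝ} (hr : Summable fun m => |r m|) :
    ∃ F, Tendsto (fun n : ℕ => Real.log (pairPartition P T c b r n) / n) atTop (𝓝 F) := by
  have hpos : ∀ n, 1 ≤ n → 0 < pairPartition P T c b r n := fun n hn =>
    (mul_pos (Real.exp_pos _) (hK n hn)).trans_le (le_pairPartition hT c b r hn)
  refine exists_tendsto_of_almost_superadditive (e := fun m => b * crossBound r m)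
    (D := |c + b * tailSum r 0|) (fun m => mul_nonneg hb (crossBound_nonneg r m)) ?_ ?_ ?_
  · simpa [mul_div_assoc] using (tendsto_crossBound_div r).const_mul b
  · intro n hn
    rw [Real.log_le_iff_le_exp (hpos n hn)]
    exact pairPartition_le hT hb hr hn
  · intro m n hm hn
    have h := Real.log_le_log (mul_pos (Real.exp_pos _) (mul_pos (hpos m hm) (hpos n hn)))
      (pairPartition_mul_le hT hb hr hm hn (c := c))
    rw [Real.log_mul (Real.exp_pos _).ne' (mul_pos (hpos m hm) (hpos n hn)).ne', Real.log_exp,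
      Real.log_mul (hpos m hm).ne' (hpos n hn).ne'] at h
    linarith

end

/-- A regularly varying function decays subexponentially along powers of two. -/
lemma exists_le_log_along_two_pow {K : ℕ → ℝ} (hKpos : ∀ n, 1 ≤ n → 0 < K n) {α : ℝ}
    {L : ℝ → ℝ} (hL : IsSlowlyVarying L)
    (hK : ∀ n : ℕ, 1 ≤ n → K n = L n * (n : ℝ) ^ (-(1 + α))) :
    ∃ (B D : ℝ), ∀ᶠ j : ℕ in atTop, -(B * j) - D ≤ Real.log (K (2 ^ j)) := by
  have h2 : Tendsto (fun j : ℕ => (2 : ℝ) ^ j) atTop atTop :=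
    tendsto_pow_atTop_atTop_of_one_lt one_lt_two
  have hr := (hL.tendsto_ratio 2 two_pos).comp h2
  have hev := hr.eventually_const_le (show (1 / 2 : ℝ) < 1 by norm_num)
  obtain ⟨N, hN⟩ := eventually_atTop.1 hev
  -- Eventually L(2x) / L(x) ≥ 1/2, so one doubling loses at most log 2 from L and exactly (1 + α)
  -- log 2 from the power.
  set B := Real.log 2 + (1 + α) * Real.log 2 with hB
  have hstep : ∀ j, N ≤ j → Real.log (K (2 ^ j)) - B ≤ Real.log (K (2 ^ (j + 1))) := by
    intro j hj
    have hp : ∀ i : ℕ, (1 : ℕ) ≤ 2 ^ i := fun i => Nat.one_le_two_pow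
    have hLpos : ∀ i : ℕ, 0 < L ((2 : ℝ) ^ i) := by
      intro i
      have h := hKpos (2 ^ i) (hp i)
      rw [hK _ (hp i)] at h
      have h3 : (0 : ℝ) < ((2 ^ i : ℕ) : ℝ) ^ (-(1 + α)) := Real.rpow_pos_of_pos (by positivity) _
      have := pos_of_mul_pos_left h h3.le
      exact_mod_cast this
    have hlog : ∀ i : ℕ, Real.log (K (2 ^ i)) =
        Real.log (L ((2 : ℝ) ^ i)) - (1 + α) * (i * Real.log 2) := by
      intro i
      rw [hK _ (hp i)]
      push_cast
      rw [Real.log_mul (hLpos i).ne' (Real.rpow_pos_of_pos (by positivity) _).ne',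
        Real.log_rpow (by positivity), Real.log_pow]
      ring
    have h := hN j hj
    simp only [Function.comp_apply] at h
    rw [← pow_succ', le_div_iff₀ (hLpos j)] at h
    have h' := Real.log_le_log (by have := hLpos j; positivity) h
    rw [Real.log_mul (by norm_num) (hLpos j).ne', one_div, Real.log_inv] at h'
    rw [hlog, hlog, hB]
    push_cast
    linarith
  refine ⟨B, -(B * N) - Real.log (K (2 ^ N)), ?_⟩
  filter_upwards [eventually_ge_atTop N] with j hj
  induction j, hj using Nat.le_induction with
  | base => linarith
  | succ j hj ih =>
    have := hstep j hj
    push_cast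
    linarith

section

variable {Ω : Type*} [MeasurableSpace Ω] {P : Measure Ω} {T : ℕ → Ω → ℕ}

/-- The single-jump path alone contributes exp(c) K(n). As the limit is known to exist, the
subsequence n = 2^j suffices, where log K(n) decreases at most linearly in j. -/
lemma nonneg_of_tendsto_log_pairPartition (hT : IsInterarrival P T)
    (hKpos : ∀ n, 1 ≤ n → 0 < stepLaw P T n) {α : ℝ} {L : ℝ → ℝ} (hL : IsSlowlyVarying L)
    (hK : ∀ n : ℕ, 1 ≤ n → stepLaw P T n = L n * (n : ℝ) ^ (-(1 + α))) {c b : ℝ}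
    {r : ℕ → ℝ} {F : ℝ}
    (hF : Tendsto (fun n : ℕ => Real.log (pairPartition P T c b r n) / n) atTop (𝓝 F)) :
    0 ≤ F := by
  obtain ⟨B, D, h⟩ := exists_le_log_along_two_pow hKpos hL hK
  have h2 : Tendsto (fun j : ℕ => 2 ^ j) atTop atTop :=
    tendsto_pow_atTop_atTop_of_one_lt one_lt_two
  have h3 : Tendsto (fun j : ℕ => -B * ((j : ℝ) ^ 1 / 2 ^ j) + (c - D) * ((j : ℝ) ^ 0 / 2 ^ j))
      atTop (𝓝 (-B * 0 + (c - D) * 0)) :=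
    ((tendsto_pow_const_div_const_pow_of_one_lt 1 one_lt_two).const_mul _).add
      ((tendsto_pow_const_div_const_pow_of_one_lt 0 one_lt_two).const_mul _)
  rw [mul_zero, mul_zero, add_zero] at h3
  refine le_of_tendsto_of_tendsto h3 (hF.comp h2) ?_
  filter_upwards [h] with j hj
  have hp : (1 : ℕ) ≤ 2 ^ j := Nat.one_le_two_pow
  have h4 := Real.log_le_log (mul_pos (Real.exp_pos _) (hKpos _ hp))
    (le_pairPartition hT c b r hp)
  rw [Real.log_mul (Real.exp_pos _).ne' (hKpos _ hp).ne', Real.log_exp] at h4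
  simp only [Function.comp_apply]
  push_cast
  rw [pow_one, pow_zero, mul_div_assoc', mul_div_assoc', ← add_div]
  refine div_le_div_of_nonneg_right ?_ (by positivity)
  linarith

end

/-! ### Mean energy per epoch, and criteria for vanishing free energy -/

section

variable {Ω : Type*} [MeasurableSpace Ω] {P : Measure Ω} {T : ℕ → Ω → ℕ}

/-- The expected pair potential between two epochs that are `m` steps apart. -/
noncomputable def meanPotential (P : Measure Ω) (T : ℕ → Ω → ℕ) (r : ℕ → ℝ) (m : ℕ) : ℝ :=
  ∫ x, r (epoch (fun i => T i x) m) ∂P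

lemma measurable_comp_epoch (hT : IsInterarrival P T) (r : ℕ → ℝ) (m : ℕ) :
    Measurable fun x => r (epoch (fun i => T i x) m) :=
  ((measurable_from_nat (f := r)).comp (measurable_epoch m)).comp hT.measurable_seq

lemma abs_le_tailSum_zero {r : ℕ → ℝ} (hr : Summable fun m => |r m|) (n : ℕ) :
    |r n| ≤ tailSum r 0 := by
  simpa [tailSum] using hr.le_tsum n fun _ _ => abs_nonneg _

variable [IsProbabilityMeasure P]

lemma integrable_comp_epoch (hT : IsInterarrival P T) {r : ℕ → ℝ} (hr : Summable fun m => |r m|)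
    (m : ℕ) : Integrable (fun x => r (epoch (fun i => T i x) m)) P :=
  Integrable.of_bound (measurable_comp_epoch hT r m).aestronglyMeasurable (tailSum r 0)
    (ae_of_all _ fun _ => abs_le_tailSum_zero hr _)

/-- On each path the epochs are distinct integers, so partial sums are bounded by `tailSum r 0`
already before integration. -/
lemma summable_integral_abs_potential (hT : IsInterarrival P T) {r : ℕ → ℝ}
    (hr : Summable fun m => |r m|) :
    Summable fun m => ∫ x, |r (epoch (fun i => T i x) (m + 1))| ∂P := by
  refine summable_of_sum_range_le (c := tailSum r 0)
    (fun m => integral_nonneg fun _ => abs_nonneg _) fun n => ?_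
  rw [← integral_finsetSum _ fun m _ => (integrable_comp_epoch hT hr (m + 1)).abs]
  refine (integral_mono (g := fun _ => tailSum r 0) (integrable_finsetSum _ fun m _ =>
    (integrable_comp_epoch hT hr (m + 1)).abs) (integrable_const _) fun x => ?_).trans_eq (by simp)
  refine sum_abs_le_tailSum hr (Finset.range n) ?_ fun _ _ => Nat.zero_le _
  intro a _ b _ hab
  have := (epoch_strictMono fun i => hT.pos i x).injective hab
  omega

lemma summable_abs_meanPotential (hT : IsInterarrival P T) {r : ℕ → ℝ}
    (hr : Summable fun m => |r m|) : Summable fun m => |meanPotential P T r (m + 1)| :=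
  (summable_integral_abs_potential hT hr).of_nonneg_of_le (fun _ => abs_nonneg _)
    fun _ => abs_integral_le_integral_abs

-- Epochs with distinct indices are distinct points, and points outside τ contribute zero. The
-- shifts by 1 discard the epoch at the origin on both sides.
omit [IsProbabilityMeasure P] in
lemma tsum_potential_eq (hT : IsInterarrival P T) (r : ℕ → ℝ) (x : Ω) :
    ∑' m, r (epoch (fun i => T i x) (m + 1)) =
      ∑' n, r (n + 1) * (renewalEvent T (n + 1)).indicator 1 x := by
  have hpos : ∀ i, 0 < T i x := fun i => hT.pos i x
  have hmono := epoch_strictMono hpos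
  have hge : ∀ m, epoch (fun i => T i x) (m + 1) - 1 + 1 = epoch (fun i => T i x) (m + 1) :=
    fun m => Nat.sub_add_cancel (le_trans (by omega) (le_epoch hpos (m + 1)))
  have hinj : Function.Injective fun m => epoch (fun i => T i x) (m + 1) - 1 := by
    intro a b hab
    have ha := hge a
    have hb := hge b
    have := hmono.injective (show epoch (fun i => T i x) (a + 1) = epoch (fun i => T i x) (b + 1) by
      simp only at hab
      omega)
    omega
  rw [← hinj.tsum_eq (f := fun n => r (n + 1) * (renewalEvent T (n + 1)).indicator 1 x)]
  · refine tsum_congr fun m => ?_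
    rw [hge, Set.indicator_of_mem (mem_renewalEvent_iff.2 ⟨m + 1, rfl⟩), Pi.one_apply, mul_one]
  · intro n hn
    have hmem : x ∈ renewalEvent T (n + 1) := by
      by_contra h
      simp [h] at hn
    obtain ⟨k, hk⟩ := mem_renewalEvent_iff.1 hmem
    cases k with
    | zero => simp [epoch] at hk
    | succ k => exact ⟨k, by simp only; omega⟩

/-- Summing over the index of the epoch or over its position gives the same result. -/
lemma tsum_meanPotential (hT : IsInterarrival P T) {r : ℕ → ℝ} (hr : Summable fun m => |r m|) :
    ∑' m, meanPotential P T r (m + 1) = ∑' n, r (n + 1) * P.real (renewalEvent T (n + 1)) := by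
  have h1 := (hasSum_integral_of_summable_integral_norm
    (fun m => integrable_comp_epoch hT hr (m + 1)) (summable_integral_abs_potential hT hr)).tsum_eq
  have hint : ∀ n : ℕ, Integrable ((renewalEvent T (n + 1)).indicator (1 : Ω → ℝ)) P := fun n =>
    (integrable_const (1 : ℝ)).indicator (measurableSet_renewalEvent hT _)
  have h2 := (hasSum_integral_of_summable_integral_norm (μ := P)
    (F := fun n x => r (n + 1) * (renewalEvent T (n + 1)).indicator 1 x)
    (fun n => (hint n).const_mul _) ?_).tsum_eq
  · simp_rw [tsum_potential_eq hT] at h1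
    simp_rw [integral_const_mul,
      fun n : ℕ => integral_indicator_one (μ := P) (measurableSet_renewalEvent hT (n + 1))] at h2
    exact h1.trans h2.symm
  · refine ((summable_nat_add_iff 1).2 hr).of_nonneg_of_le
      (fun n => integral_nonneg fun _ => norm_nonneg _) fun n => ?_
    simp_rw [norm_mul, integral_const_mul, Real.norm_eq_abs]
    refine mul_le_of_le_one_right (abs_nonneg _) ?_
    have : ∀ x, |(renewalEvent T (n + 1)).indicator (1 : Ω → ℝ) x| =
        (renewalEvent T (n + 1)).indicator 1 x := fun x =>
      abs_of_nonneg (Set.indicator_nonneg (fun _ _ => zero_le_one) _)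
    simp_rw [this]
    rw [integral_indicator_one (measurableSet_renewalEvent hT _)]
    exact measureReal_le_one

/-- The mean interaction energy per epoch. -/
lemma tendsto_integral_pairEnergy_div (hT : IsInterarrival P T) {r : ℕ → ℝ}
    (hr : Summable fun m => |r m|) :
    Tendsto (fun k : ℕ => (∫ x, pairEnergy r k (fun i => T i x) ∂P) / k) atTop
      (𝓝 (∑' n, r (n + 1) * P.real (renewalEvent T (n + 1)))) := by
  have hlaw : ∀ i d : ℕ, ∫ x, r (epoch (fun a => T a x) (i + d) - epoch (fun a => T a x) i) ∂P =
      meanPotential P T r d := by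
    intro i d
    simp_rw [epoch_add, Nat.add_sub_cancel_left]
    exact hT.integral_shift i (f := fun t => r (epoch t d))
      ((measurable_from_nat (f := r)).comp (measurable_epoch d))
  have hint : ∀ i j, Integrable
      (fun x => r (epoch (fun a => T a x) j - epoch (fun a => T a x) i)) P := by
    intro i j
    refine Integrable.of_bound (Measurable.aestronglyMeasurable ?_) (tailSum r 0)
      (ae_of_all _ fun _ => abs_le_tailSum_zero hr _)
    exact (measurable_from_nat (f := r)).comp (((measurable_epoch j).comp hT.measurable_seq).sub
      ((measurable_epoch i).comp hT.measurable_seq))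
  have h1 : ∀ k : ℕ, ∫ x, pairEnergy r k (fun i => T i x) ∂P =
      ∑ j ∈ Finset.range k, ∑ m ∈ Finset.range j, meanPotential P T r (m + 1) := by
    intro k
    simp_rw [pairEnergy]
    rw [integral_finsetSum _ fun j _ => integrable_finsetSum _ fun i _ => hint _ _]
    refine Finset.sum_congr rfl fun j _ => ?_
    rw [integral_finsetSum _ fun i _ => hint _ _,
      ← Finset.sum_range_reflect (fun m => meanPotential P T r (m + 1))]
    refine Finset.sum_congr rfl fun i hi => ?_
    rw [Finset.mem_range] at hi
    rw [← hlaw (i + 1) (j - 1 - i + 1), show i + 1 + (j - 1 - i + 1) = j + 1 by omega]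
  rw [← tsum_meanPotential hT hr]
  -- By `h1` the mean energy adds up partial sums of one convergent series, so dividing by k gives
  -- their Cesàro mean.
  have h2 := (summable_abs_meanPotential hT hr).of_abs.hasSum.tendsto_sum_nat.cesaro
  refine h2.congr fun k => ?_
  rw [h1, div_eq_inv_mul]

lemma integrable_pairEnergy (hT : IsInterarrival P T) {r : ℕ → ℝ}
    (hr : Summable fun m => |r m|) (k : ℕ) :
    Integrable (fun x => pairEnergy r k (fun i => T i x)) P :=
  Integrable.of_bound ((measurable_pairEnergy r k).comp hT.measurable_seq).aestronglyMeasurable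
    (k * tailSum r 0) (ae_of_all _ fun x => abs_pairEnergy_le hr (fun i => hT.pos i x) k)

lemma integral_const_add_mul_sub {f : Ω → ℝ} (hf : Integrable f P) (a b d : ℝ) :
    Integrable (fun x => a + b * (f x - d)) P ∧
      ∫ x, (a + b * (f x - d)) ∂P = a + b * (∫ x, f x ∂P - d) := by
  have h1 : Integrable (fun x => f x - d) P := hf.sub (integrable_const d)
  refine ⟨(integrable_const a).add (h1.const_mul b), ?_⟩
  rw [integral_add (integrable_const a) (h1.const_mul b), integral_const_mul,
    integral_sub hf (integrable_const d)]
  simp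

lemma integrable_weight (hT : IsInterarrival P T) {c b : ℝ} (hb : 0 ≤ b) {r : ℕ → ℝ}
    (hr : Summable fun m => |r m|) (k : ℕ) :
    Integrable (fun x => weight c b r k (fun i => T i x)) P := by
  simpa using integrable_weight_mul hT (c := c) hb hr k (ψ := fun _ => 1) measurable_const
    (M := 1) (by simp)

omit [IsProbabilityMeasure P] in
lemma blockWeight_one_right (c b : ℝ) (r : ℕ → ℝ) (k : ℕ) :
    blockWeight P T c b r k 1 = ∫ x, weight c b r k (fun i => T i x) ∂P := by
  simp [blockWeight]

/-- Jensen's inequality for the block weights. -/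
lemma exp_le_blockWeight (hT : IsInterarrival P T) {c b : ℝ} (hb : 0 ≤ b) {r : ℕ → ℝ}
    (hr : Summable fun m => |r m|) (k : ℕ) :
    Real.exp (c * k + b * ∫ x, pairEnergy r k (fun i => T i x) ∂P) ≤
      blockWeight P T c b r k 1 := by
  rw [blockWeight_one_right]
  have hG := integrable_pairEnergy hT hr k
  set g := ∫ x, pairEnergy r k (fun i => T i x) ∂P with hg
  set m := c * k + b * g with hm
  -- Tangent line of exp at the mean: exp(m + y) ≥ exp(m) (1 + y), and the centred y integrates to
  -- 0.
  have h : ∫ x, Real.exp m * (1 + b * (pairEnergy r k (fun i => T i x) - g)) ∂P ≤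
      ∫ x, weight c b r k (fun i => T i x) ∂P := by
    refine integral_mono ((integral_const_add_mul_sub hG 1 b g).1.const_mul _)
      (integrable_weight hT hb hr k) fun x => ?_
    simp only [weight]
    have h1 := Real.add_one_le_exp (b * (pairEnergy r k (fun i => T i x) - g))
    have h2 : c * k + b * pairEnergy r k (fun i => T i x) =
        m + b * (pairEnergy r k (fun i => T i x) - g) := by
      rw [hm]
      ring
    rw [h2, Real.exp_add m]
    exact mul_le_mul_of_nonneg_left (by linarith) (Real.exp_pos _).le
  rw [integral_const_mul, (integral_const_add_mul_sub hG 1 b g).2, ← hg] at h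
  simpa using h

/-- The geometric damping `n ↦ exp (-l n)`. -/
noncomputable def damping (l : ℝ) (n : ℕ) : ℝ := Real.exp (-(l * n))

lemma damping_mem_Icc {l : ℝ} (hl : 0 ≤ l) (n : ℕ) : damping l n ∈ Set.Icc (0 : ℝ) 1 :=
  ⟨(Real.exp_pos _).le, Real.exp_le_one_iff.2 (neg_nonpos.2 (by positivity))⟩

lemma damping_pos (l : ℝ) (n : ℕ) : 0 < damping l n := Real.exp_pos _

lemma damping_add (l : ℝ) (m n : ℕ) : damping l (m + n) = damping l m * damping l n := by
  rw [damping, damping, damping, ← Real.exp_add]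
  congr 1
  push_cast
  ring

omit [IsProbabilityMeasure P] in
lemma jointWeight_damping (c b : ℝ) (r : ℕ → ℝ) (k m : ℕ) (l : ℝ) :
    jointWeight P T c b r k m (damping l) (damping l) =
      blockWeight P T c b r (k + m) (damping l) := by
  simp_rw [jointWeight, blockWeight, ← damping_add, epoch_add]

/-- Powers of the damped weight of one block are dominated by the weight of many blocks. -/
lemma pow_le_blockWeight (hT : IsInterarrival P T) {c b : ℝ} (hb : 0 ≤ b) {r : ℕ → ℝ}
    (hr : Summable fun m => |r m|) {l : ℝ} (hl : 0 ≤ l) (k q : ℕ) :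
    (Real.exp (-(b * crossBound r k)) * blockWeight P T c b r k (damping l)) ^ q ≤
      blockWeight P T c b r (q * k) (damping l) := by
  induction q with
  | zero => simp [blockWeight, weight, pairEnergy, damping, epoch]
  | succ q ih =>
    have h := le_jointWeight hT (c := c) hb hr k (q * k) (damping_mem_Icc hl) (damping_mem_Icc hl)
    rw [jointWeight_damping] at h
    rw [pow_succ', add_mul, one_mul, add_comm (q * k)]
    refine le_trans (mul_le_mul_of_nonneg_left ih (mul_nonneg (Real.exp_pos _).le
      (blockWeight_nonneg fun n => (damping_mem_Icc hl n).1))) ?_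
    rwa [mul_assoc]

/-- If the damped partition functions are summable, the damped block weights are bounded. -/
lemma blockWeight_damping_le_tsum (hT : IsInterarrival P T) {c b : ℝ} (hb : 0 ≤ b) {r : ℕ → ℝ}
    (hr : Summable fun m => |r m|) {l : ℝ}
    (hs : Summable fun n => damping l (n + 1) * pairPartition P T c b r (n + 1)) {k : ℕ}
    (hk : 1 ≤ k) :
    blockWeight P T c b r k (damping l) ≤
      ∑' n, damping l (n + 1) * pairPartition P T c b r (n + 1) := by
  -- Since k epochs occupy length at least k, the block weight vanishes for shorter systems, where
  -- it is not a term of the partition function.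
  have hle : ∀ n, blockWeight P T c b r k (pointMass (n + 1)) ≤
      pairPartition P T c b r (n + 1) := by
    intro n
    by_cases h : k ≤ n + 1
    · exact blockWeight_le_pairPartition (Finset.mem_Icc.2 ⟨hk, h⟩)
    · have h0 : blockWeight P T c b r k (pointMass (n + 1)) = 0 := by
        rw [blockWeight]
        refine (integral_congr_ae (ae_of_all _ fun x => ?_)).trans (integral_zero _ _)
        have := le_epoch (fun i => hT.pos i x) k
        have hne : epoch (fun i => T i x) k ≠ n + 1 := by omega
        simp [pointMass, hne]
      rw [h0]
      exact Finset.sum_nonneg fun _ _ => blockWeight_nonneg fun _ => (pointMass_mem_Icc _ _).1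
  have hle' : ∀ n, damping l (n + 1) * blockWeight P T c b r k (pointMass (n + 1)) ≤
      damping l (n + 1) * pairPartition P T c b r (n + 1) := fun n =>
    mul_le_mul_of_nonneg_left (hle n) (Real.exp_pos _).le
  have hnn : ∀ n x, 0 ≤ weight c b r k (fun i => T i x) *
      pointMass (n + 1) (epoch (fun i => T i x) k) := fun n x =>
    mul_nonneg (weight_pos _ _ _ _ _).le (pointMass_mem_Icc _ _).1
  have hs' : Summable fun n => damping l (n + 1) * blockWeight P T c b r k (pointMass (n + 1)) :=
    hs.of_nonneg_of_le (fun n => mul_nonneg (Real.exp_pos _).le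
      (blockWeight_nonneg fun _ => (pointMass_mem_Icc _ _).1)) hle'
  have h := (hasSum_integral_of_summable_integral_norm (μ := P)
    (F := fun n x => damping l (n + 1) * (weight c b r k (fun i => T i x) *
      pointMass (n + 1) (epoch (fun i => T i x) k)))
    (fun n => (integrable_weight_mul_comp_epoch hT hb hr k (pointMass_mem_Icc _)).const_mul _)
    ?_).tsum_eq
  · simp_rw [integral_const_mul] at h
    -- Summing over all endpoints restores the damping at the actual epoch; endpoint 0 may be
    -- omitted because k ≥ 1.
    have e : ∀ x, ∑' n, damping l (n + 1) * (weight c b r k (fun i => T i x) *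
        pointMass (n + 1) (epoch (fun i => T i x) k)) =
        weight c b r k (fun i => T i x) * damping l (epoch (fun i => T i x) k) := by
      intro x
      have hge := le_epoch (fun i => hT.pos i x) k
      rw [tsum_eq_single (epoch (fun i => T i x) k - 1)]
      · rw [Nat.sub_add_cancel (by omega)]
        simp [pointMass, mul_comm]
      · intro n hn
        have hne : epoch (fun i => T i x) k ≠ n + 1 := by omega
        simp [pointMass, hne]
    simp_rw [e] at h
    rw [blockWeight, ← h]
    exact hs'.tsum_le_tsum hle' hs
  · refine hs'.congr fun n => ?_
    rw [blockWeight, ← integral_const_mul]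
    refine integral_congr_ae (ae_of_all _ fun x => ?_)
    simp only
    rw [Real.norm_of_nonneg (mul_nonneg (damping_pos _ _).le (hnn n x))]

/-- Zero exponential rate means Z n < exp(l n / 2) eventually, so half of the damping survives as a
geometric ratio exp(-l / 2). -/
lemma summable_damping_mul {Z : ℕ → ℝ} (hZ : ∀ n, 1 ≤ n → 0 < Z n)
    (hF : Tendsto (fun n : ℕ => Real.log (Z n) / n) atTop (𝓝 0)) {l : ℝ} (hl : 0 < l) :
    Summable fun n => damping l (n + 1) * Z (n + 1) := by
  have h1 : Summable fun n : ℕ => Real.exp (-(l / 2)) ^ n :=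
    summable_geometric_of_lt_one (Real.exp_pos _).le (Real.exp_lt_one_iff.2 (by linarith))
  have h2 : Summable fun n => damping l n * Z n := by
    refine summable_of_isBigO_nat h1 (Asymptotics.IsBigO.of_bound 1 ?_)
    filter_upwards [hF.eventually_lt_const (half_pos hl), eventually_ge_atTop 1] with n hn hn1
    have hn' : (0 : ℝ) < n := Nat.cast_pos.2 hn1
    rw [div_lt_iff₀ hn', Real.log_lt_iff_lt_exp (hZ n hn1)] at hn
    rw [Real.norm_of_nonneg (mul_nonneg (damping_pos _ _).le (hZ n hn1).le),
      Real.norm_of_nonneg (by positivity), one_mul, ← Real.exp_nat_mul]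
    refine (mul_le_mul_of_nonneg_left hn.le (damping_pos _ _).le).trans_eq ?_
    rw [damping, ← Real.exp_add]
    congr 1
    ring
  exact (summable_nat_add_iff 1).2 h2

lemma tendsto_blockWeight_damping (hT : IsInterarrival P T) {c b : ℝ} (hb : 0 ≤ b) {r : ℕ → ℝ}
    (hr : Summable fun m => |r m|) (k : ℕ) :
    Tendsto (fun l => blockWeight P T c b r k (damping l)) (𝓝[>] 0)
      (𝓝 (blockWeight P T c b r k 1)) := by
  refine tendsto_integral_filter_of_dominated_convergence
    (fun x => weight c b r k (fun i => T i x)) ?_ ?_ (integrable_weight hT hb hr k) ?_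
  · exact Eventually.of_forall fun l =>
      ((measurable_weight_mul_epoch c b r k _).comp hT.measurable_seq).aestronglyMeasurable
  · filter_upwards [self_mem_nhdsWithin] with l hl
    refine ae_of_all _ fun x => ?_
    have h := damping_mem_Icc (le_of_lt (Set.mem_Ioi.1 hl)) (epoch (fun i => T i x) k)
    rw [Real.norm_of_nonneg (mul_nonneg (weight_pos _ _ _ _ _).le h.1)]
    exact mul_le_of_le_one_right (weight_pos _ _ _ _ _).le h.2
  · refine ae_of_all _ fun x => ?_
    have h : Continuous fun l : ℝ => weight c b r k (fun i => T i x) *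
        damping l (epoch (fun i => T i x) k) := by
      unfold damping
      fun_prop
    have h' := (h.tendsto 0).mono_left (nhdsWithin_le_nhds (s := Set.Ioi 0))
    simpa [damping] using h'

/-- If the free energy vanishes, a block weight is at most the cost of decoupling. -/
lemma blockWeight_le_of_freeEnergy_eq_zero (hT : IsInterarrival P T)
    (hK : ∀ n, 1 ≤ n → 0 < stepLaw P T n) {c b : ℝ} (hb : 0 ≤ b) {r : ℕ → ℝ}
    (hr : Summable fun m => |r m|)
    (hF : Tendsto (fun n : ℕ => Real.log (pairPartition P T c b r n) / n) atTop (𝓝 0))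
    {k : ℕ} (hk : 1 ≤ k) :
    Real.exp (-(b * crossBound r k)) * blockWeight P T c b r k 1 ≤ 1 := by
  refine le_of_tendsto ((tendsto_blockWeight_damping hT hb hr k).const_mul _) ?_
  filter_upwards [self_mem_nhdsWithin] with l hl
  rw [Set.mem_Ioi] at hl
  -- A base above 1 has unbounded powers, yet these are dominated by damped weights of q * k epochs,
  -- which the convergent series bounds uniformly in q.
  by_contra! hgt
  have hs := summable_damping_mul (fun n hn =>
    (mul_pos (Real.exp_pos _) (hK n hn)).trans_le (le_pairPartition hT c b r hn)) hF hl
  obtain ⟨q, hq⟩ := ((tendsto_pow_atTop_atTop_of_one_lt hgt).eventually_gt_atTop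
    (∑' n, damping l (n + 1) * pairPartition P T c b r (n + 1))).and
      (eventually_ge_atTop 1) |>.exists
  have h1 := pow_le_blockWeight hT (c := c) hb hr hl.le k q
  have h2 := blockWeight_damping_le_tsum hT hb hr hs (k := q * k) (Nat.mul_pos hq.2 hk)
  linarith [hq.1]

/-- Upper bound for the parameters with vanishing free energy. -/
lemma le_of_freeEnergy_eq_zero (hT : IsInterarrival P T)
    (hK : ∀ n, 1 ≤ n → 0 < stepLaw P T n) {c b : ℝ} (hb : 0 ≤ b) {r : ℕ → ℝ}
    (hr : Summable fun m => |r m|)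
    (hF : Tendsto (fun n : ℕ => Real.log (pairPartition P T c b r n) / n) atTop (𝓝 0)) :
    c ≤ -(b * ∑' n, r (n + 1) * P.real (renewalEvent T (n + 1))) := by
  have h1 := ((tendsto_crossBound_div r).const_mul b).sub
    ((tendsto_integral_pairEnergy_div hT hr).const_mul b)
  rw [mul_zero, zero_sub] at h1
  refine ge_of_tendsto h1 ?_
  filter_upwards [eventually_ge_atTop 1] with k hk
  have h2 := blockWeight_le_of_freeEnergy_eq_zero hT hK hb hr hF hk
  have h3 := (mul_le_mul_of_nonneg_left (exp_le_blockWeight hT (c := c) hb hr k)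
    (Real.exp_pos (-(b * crossBound r k))).le).trans h2
  rw [← Real.exp_add, Real.exp_le_one_iff] at h3
  have hk' : (0 : ℝ) < k := Nat.cast_pos.2 hk
  rw [mul_div_assoc', mul_div_assoc', ← sub_div, le_div_iff₀ hk']
  linarith

lemma blockWeight_add_le (hT : IsInterarrival P T) {c b : ℝ} (hb : 0 ≤ b) {r : ℕ → ℝ}
    (hr : Summable fun m => |r m|) (k m : ℕ) :
    blockWeight P T c b r (k + m) 1 ≤ Real.exp (b * crossBound r k) *
      (blockWeight P T c b r k 1 * blockWeight P T c b r m 1) := by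
  have h := jointWeight_le hT (c := c) hb hr k m (φ := 1) (ψ := 1) (by simp) (by simp)
  simpa [jointWeight, blockWeight] using h

/-- If one block weight does not exceed the gain of decoupling, the free energy is
nonpositive. -/
lemma freeEnergy_nonpos_of_blockWeight_le (hT : IsInterarrival P T)
    (hK : ∀ n, 1 ≤ n → 0 < stepLaw P T n) {c b : ℝ} (hb : 0 ≤ b) {r : ℕ → ℝ}
    (hr : Summable fun m => |r m|) {F : ℝ}
    (hF : Tendsto (fun n : ℕ => Real.log (pairPartition P T c b r n) / n) atTop (𝓝 F))
    {k : ℕ} (hk : 1 ≤ k)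
    (h : Real.exp (b * crossBound r k) * blockWeight P T c b r k 1 ≤ 1) : F ≤ 0 := by
  have hnn : ∀ j, 0 ≤ blockWeight P T c b r j 1 := fun j =>
    blockWeight_nonneg fun _ => zero_le_one
  -- By `h`, stripping off k epochs never decreases the bound, so every block weight is controlled
  -- by one with at most k epochs.
  set M := ∑ i ∈ Finset.range (k + 1), blockWeight P T c b r i 1 with hM
  have hbound : ∀ j, blockWeight P T c b r j 1 ≤ M := by
    intro j
    induction j using Nat.strong_induction_on with
    | _ j ih =>
      rcases le_or_gt j k with hj | hj
      · exact Finset.single_le_sum (f := fun i => blockWeight P T c b r i 1)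
          (fun i _ => hnn i) (Finset.mem_range.2 (by omega))
      · have h1 := blockWeight_add_le hT (c := c) hb hr k (j - k)
        rw [Nat.add_sub_cancel' hj.le, ← mul_assoc] at h1
        exact (h1.trans (mul_le_of_le_one_left (hnn _) h)).trans (ih _ (by omega))
  have hZ : ∀ n : ℕ, pairPartition P T c b r n ≤ n * M := by
    intro n
    have : ∀ j ∈ Finset.Icc 1 n, blockWeight P T c b r j (pointMass n) ≤ M := by
      intro j _
      refine le_trans ?_ (hbound j)
      rw [blockWeight_one_right]
      refine integral_mono (integrable_weight_mul_comp_epoch hT hb hr j (pointMass_mem_Icc n))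
        (integrable_weight hT hb hr j) fun x => ?_
      exact mul_le_of_le_one_right (weight_pos _ _ _ _ _).le (pointMass_mem_Icc _ _).2
    refine (Finset.sum_le_sum this).trans_eq ?_
    simp
  have hlog : Tendsto (fun n : ℕ => Real.log n / n + Real.log M / n) atTop (𝓝 (0 + 0)) := by
    refine Tendsto.add ?_ (tendsto_const_div_atTop_nhds_zero_nat _)
    have := Real.isLittleO_log_id_atTop.tendsto_div_nhds_zero.comp tendsto_natCast_atTop_atTop
    exact this
  rw [add_zero] at hlog
  refine le_of_tendsto_of_tendsto hF hlog ?_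
  filter_upwards [eventually_ge_atTop 1] with n hn
  have hn' : (0 : ℝ) < n := Nat.cast_pos.2 hn
  have hZpos := (mul_pos (Real.exp_pos _) (hK n hn)).trans_le (le_pairPartition hT c b r hn)
  have hMpos : 0 < M := pos_of_mul_pos_right (hZpos.trans_le (hZ n)) hn'.le
  rw [← add_div, ← Real.log_mul hn'.ne' hMpos.ne']
  exact div_le_div_of_nonneg_right (Real.log_le_log hZpos (hZ n)) hn'.le

/-- For `c` very negative the block weights are small. -/
lemma freeEnergy_nonpos_of_le (hT : IsInterarrival P T)
    (hK : ∀ n, 1 ≤ n → 0 < stepLaw P T n) {c b : ℝ} (hb : 0 ≤ b) {r : ℕ → ℝ}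
    (hr : Summable fun m => |r m|) {F : ℝ}
    (hF : Tendsto (fun n : ℕ => Real.log (pairPartition P T c b r n) / n) atTop (𝓝 F))
    (hc : c ≤ -(b * crossBound r 1)) : F ≤ 0 := by
  refine freeEnergy_nonpos_of_blockWeight_le hT hK hb hr hF le_rfl ?_
  rw [blockWeight_one_right]
  simp_rw [weight_one]
  rw [integral_const, smul_eq_mul, probReal_univ, one_mul, ← Real.exp_add, Real.exp_le_one_iff]
  linarith

/-- Second order expansion of the block weights at high temperature. -/
lemma eventually_blockWeight_le (hT : IsInterarrival P T) {r : ℕ → ℝ}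
    (hr : Summable fun m => |r m|) {κ : ℝ}
    (hκ : ∑' n, r (n + 1) * P.real (renewalEvent T (n + 1)) < κ) :
    ∃ k, 1 ≤ k ∧ ∀ᶠ b in 𝓝[>] (0 : ℝ),
      Real.exp (b * crossBound r k) * blockWeight P T (-(κ * b)) b r k 1 ≤ 1 := by
  -- The block length k is fixed first, so large that X_k + E G_k < κ k; only afterwards does b tend
  -- to 0.
  have h1 := ((tendsto_crossBound_div r).add (tendsto_integral_pairEnergy_div hT hr))
  rw [zero_add] at h1
  obtain ⟨k, hk, hk1⟩ := ((h1.eventually_lt_const hκ).and (eventually_ge_atTop 1)).exists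
  refine ⟨k, hk1, ?_⟩
  have hk' : (0 : ℝ) < k := Nat.cast_pos.2 hk1
  set g := ∫ x, pairEnergy r k (fun i => T i x) ∂P with hg
  -- A uniform bound for |G - κ k|: once b M < 1, the second-order remainder of the exponential is
  -- at most (b M)².
  set M := |κ| * k + k * tailSum r 0 with hM
  have hMnn : 0 ≤ M := by
    have := tailSum_nonneg r 0
    positivity
  have hneg : crossBound r k + g - κ * k < 0 := by
    rw [← add_div, div_lt_iff₀ hk'] at hk
    linarith
  have hsmall : ∀ᶠ b in 𝓝[>] (0 : ℝ), b * M < 1 := by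
    have : Tendsto (fun b : ℝ => b * M) (𝓝 0) (𝓝 (0 * M)) := tendsto_id.mul_const M
    rw [zero_mul] at this
    exact nhdsWithin_le_nhds (this.eventually_lt_const one_pos)
  have hsmall' : ∀ᶠ b in 𝓝[>] (0 : ℝ), crossBound r k + g - κ * k + b * M ^ 2 < 0 := by
    have : Tendsto (fun b : ℝ => crossBound r k + g - κ * k + b * M ^ 2) (𝓝 0)
        (𝓝 (crossBound r k + g - κ * k + 0 * M ^ 2)) :=
      (tendsto_id.mul_const _).const_add _
    rw [zero_mul, add_zero] at this
    exact nhdsWithin_le_nhds (this.eventually_lt_const hneg)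
  filter_upwards [hsmall, hsmall', self_mem_nhdsWithin] with b hb1 hb2 hb
  rw [Set.mem_Ioi] at hb
  have hint := integrable_pairEnergy hT hr k
  have h2 : blockWeight P T (-(κ * b)) b r k 1 ≤
      1 + (b * (g - κ * k) + (b * M) ^ 2) := by
    rw [blockWeight_one_right]
    have h3 : ∫ x, weight (-(κ * b)) b r k (fun i => T i x) ∂P ≤
        ∫ x, (1 + (b * M) ^ 2 + b * (pairEnergy r k (fun i => T i x) - κ * k)) ∂P := by
      refine integral_mono (integrable_weight hT hb.le hr k)
        (integral_const_add_mul_sub hint (1 + (b * M) ^ 2) b (κ * k)).1 fun x => ?_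
      simp only [weight]
      set G := pairEnergy r k (fun i => T i x)
      have hG : |G - κ * k| ≤ M := by
        have hG' := abs_pairEnergy_le hr (fun i => hT.pos i x) k
        calc |G - κ * k| ≤ |G| + |κ * k| := abs_sub _ _
          _ ≤ k * tailSum r 0 + |κ| * k := by
            rw [abs_mul, abs_of_pos hk']
            gcongr
          _ = M := by rw [hM]; ring
      have hy : |b * (G - κ * k)| ≤ b * M := by
        rw [abs_mul, abs_of_pos hb]
        exact mul_le_mul_of_nonneg_left hG hb.le
      have he := Real.abs_exp_sub_one_sub_id_le (hy.trans hb1.le)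
      have he' := (le_abs_self _).trans he
      have hsq : (b * (G - κ * k)) ^ 2 ≤ (b * M) ^ 2 := sq_le_sq' (by
        linarith [neg_abs_le (b * (G - κ * k))]) ((le_abs_self _).trans hy)
      rw [show -(κ * b) * k + b * G = b * (G - κ * k) by ring]
      linarith
    rw [(integral_const_add_mul_sub hint _ _ _).2, ← hg] at h3
    linarith
  have h4 : blockWeight P T (-(κ * b)) b r k 1 ≤ Real.exp (-(b * crossBound r k)) := by
    -- The strict first-order gain absorbs the quadratic remainder and the decoupling cost: 1 + b (g
    -- - κ k) + (b M)² ≤ 1 - b X_k.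
    refine h2.trans (le_trans ?_ (Real.add_one_le_exp _))
    have := mul_neg_of_pos_of_neg hb hb2
    nlinarith
  refine (mul_le_mul_of_nonneg_left h4 (Real.exp_pos _).le).trans_eq ?_
  rw [← Real.exp_add, add_neg_cancel, Real.exp_zero]

end

/-! ### Averages of powers of an isometry -/

section Hilbert

variable {H : Type*} [NormedAddCommGroup H] [InnerProductSpace ℝ H]

/-- The powers of an isometry as continuous linear maps. -/
noncomputable def isometryPow (U : H →ₗᵢ[ℝ] H) (n : ℕ) : H →L[ℝ] H := U.toContinuousLinearMap ^ n

lemma isometryPow_add (U : H →ₗᵢ[ℝ] H) (m n : ℕ) :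
    isometryPow U (m + n) = isometryPow U m * isometryPow U n := pow_add _ _ _

lemma isometryPow_one (U : H →ₗᵢ[ℝ] H) (v : H) : isometryPow U 1 v = U v := by
  simp [isometryPow]

lemma isometryPow_succ_apply (U : H →ₗᵢ[ℝ] H) (n : ℕ) (v : H) :
    isometryPow U (n + 1) v = U (isometryPow U n v) := by
  rw [add_comm, isometryPow_add, mul_apply_eq_comp, isometryPow_one]

lemma isometryPow_comm_apply (U : H →ₗᵢ[ℝ] H) (n : ℕ) (v : H) :
    isometryPow U n (U v) = U (isometryPow U n v) := by
  rw [← isometryPow_succ_apply, isometryPow_add, mul_apply_eq_comp, isometryPow_one]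

lemma norm_isometryPow_apply (U : H →ₗᵢ[ℝ] H) (n : ℕ) (v : H) : ‖isometryPow U n v‖ = ‖v‖ := by
  induction n with
  | zero => simp [isometryPow]
  | succ n ih => rw [isometryPow_succ_apply, U.norm_map, ih]

lemma norm_isometryPow_le (U : H →ₗᵢ[ℝ] H) (n : ℕ) : ‖isometryPow U n‖ ≤ 1 :=
  ContinuousLinearMap.opNorm_le_bound _ zero_le_one fun v => by
    rw [norm_isometryPow_apply, one_mul]

/-- The mean of the powers of an isometry with respect to a law on `ℕ`. -/
noncomputable def meanIsometry (U : H →ₗᵢ[ℝ] H) (κ : Measure ℕ) : H →L[ℝ] H :=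
  ∫ n, isometryPow U n ∂κ

lemma integrable_isometryPow (U : H →ₗᵢ[ℝ] H) (κ : Measure ℕ) [IsFiniteMeasure κ] :
    Integrable (isometryPow U) κ :=
  Integrable.of_bound StronglyMeasurable.of_discrete.aestronglyMeasurable 1
    (ae_of_all _ (norm_isometryPow_le U))

lemma integrable_isometryPow_apply (U : H →ₗᵢ[ℝ] H) (κ : Measure ℕ) [IsFiniteMeasure κ] (v : H) :
    Integrable (fun n => isometryPow U n v) κ :=
  Integrable.of_bound StronglyMeasurable.of_discrete.aestronglyMeasurable ‖v‖
    (ae_of_all _ fun n => (norm_isometryPow_apply U n v).le)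

variable [CompleteSpace H]

omit [CompleteSpace H] in
lemma meanIsometry_apply (U : H →ₗᵢ[ℝ] H) (κ : Measure ℕ) [IsFiniteMeasure κ] (v : H) :
    meanIsometry U κ v = ∫ n, isometryPow U n v ∂κ :=
  ContinuousLinearMap.integral_apply (integrable_isometryPow U κ) v

omit [CompleteSpace H] in
lemma norm_meanIsometry_le (U : H →ₗᵢ[ℝ] H) (κ : Measure ℕ) [IsProbabilityMeasure κ] :
    ‖meanIsometry U κ‖ ≤ 1 := by
  simpa [meanIsometry] using
    norm_integral_le_of_norm_le_const (μ := κ) (ae_of_all _ (norm_isometryPow_le U))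

lemma meanIsometry_comm_apply (U : H →ₗᵢ[ℝ] H) (κ : Measure ℕ) [IsFiniteMeasure κ] (v : H) :
    meanIsometry U κ (U v) = U (meanIsometry U κ v) := by
  rw [meanIsometry_apply, meanIsometry_apply]
  simp_rw [isometryPow_comm_apply]
  exact U.toContinuousLinearMap.integral_comp_comm (integrable_isometryPow_apply U κ v)

/-- The norm defect of the mean of the powers of an isometry is a variance. -/
lemma norm_sq_sub_norm_meanIsometry_sq (U : H →ₗᵢ[ℝ] H) (κ : Measure ℕ) [IsProbabilityMeasure κ]
    (v : H) :
    ‖v‖ ^ 2 - ‖meanIsometry U κ v‖ ^ 2 =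
      ∫ n, ‖isometryPow U n v - meanIsometry U κ v‖ ^ 2 ∂κ := by
  set w := meanIsometry U κ v with hw
  have hint := integrable_isometryPow_apply U κ v
  have h1 : ∀ n, ‖isometryPow U n v - w‖ ^ 2 =
      (‖v‖ ^ 2 + ‖w‖ ^ 2) - 2 * inner ℝ w (isometryPow U n v) := by
    intro n
    rw [norm_sub_sq_real, norm_isometryPow_apply, real_inner_comm]
    ring
  simp_rw [h1]
  rw [integral_sub (integrable_const _) ((hint.const_inner w).const_mul 2), integral_const_mul,
    integral_inner hint, ← meanIsometry_apply, ← hw, real_inner_self_eq_norm_sq]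
  simp
  ring

/-- The defect is a variance. Keeping only the atoms 1 and 2 leaves the squared distances of U v and
U² v from the mean, and these two points are ‖U v - v‖ apart. -/
lemma le_norm_sq_sub_norm_meanIsometry_sq (U : H →ₗᵢ[ℝ] H) (κ : Measure ℕ)
    [IsProbabilityMeasure κ] {p : ℝ} (hp : 0 ≤ p) (h1 : p ≤ κ.real {1}) (h2 : p ≤ κ.real {2})
    (v : H) :
    p / 2 * ‖U v - v‖ ^ 2 ≤ ‖v‖ ^ 2 - ‖meanIsometry U κ v‖ ^ 2 := by
  rw [norm_sq_sub_norm_meanIsometry_sq]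
  set w := meanIsometry U κ v with hw
  set f : ℕ → ℝ := fun n => ‖isometryPow U n v - w‖ ^ 2 with hf
  have hb : ∀ n, ‖f n‖ ≤ (‖v‖ + ‖w‖) ^ 2 := by
    intro n
    rw [Real.norm_of_nonneg (sq_nonneg _)]
    refine pow_le_pow_left₀ (norm_nonneg _) ((norm_sub_le _ _).trans ?_) 2
    rw [norm_isometryPow_apply]
  have hfi : Integrable f κ :=
    Integrable.of_bound StronglyMeasurable.of_discrete.aestronglyMeasurable _ (ae_of_all _ hb)
  have hi : ∀ n : ℕ, Integrable (({n} : Set ℕ).indicator fun _ => f n) κ := fun n =>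
    (integrable_const _).indicator (measurableSet_singleton n)
  have hle : κ.real {1} * f 1 + κ.real {2} * f 2 ≤ ∫ n, f n ∂κ := by
    have h : ∫ n, (({1} : Set ℕ).indicator (fun _ => f 1) n +
        ({2} : Set ℕ).indicator (fun _ => f 2) n) ∂κ ≤ ∫ n, f n ∂κ := by
      refine integral_mono ((hi 1).add (hi 2)) hfi fun n => ?_
      have hn : 0 ≤ f n := sq_nonneg _
      by_cases e1 : n = 1
      · subst e1
        simp
      · by_cases e2 : n = 2
        · subst e2
          simp
        · simpa [e1, e2] using hn
    rw [integral_add (hi 1) (hi 2), integral_indicator_const _ (measurableSet_singleton _),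
      integral_indicator_const _ (measurableSet_singleton _)] at h
    exact h
  have h3 : ‖U v - v‖ ^ 2 ≤ 2 * (f 1 + f 2) := by
    have e : ‖U v - v‖ = ‖isometryPow U 2 v - isometryPow U 1 v‖ := by
      rw [isometryPow_succ_apply U 1, isometryPow_one, ← map_sub, U.norm_map]
    have ht := norm_sub_le (isometryPow U 2 v - w) (isometryPow U 1 v - w)
    rw [sub_sub_sub_cancel_right, ← e] at ht
    simp only [hf]
    nlinarith [norm_nonneg (U v - v), sq_nonneg (‖isometryPow U 2 v - w‖ -
      ‖isometryPow U 1 v - w‖), norm_nonneg (isometryPow U 2 v - w),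
      norm_nonneg (isometryPow U 1 v - w)]
  have f1 : 0 ≤ f 1 := sq_nonneg _
  have f2 : 0 ≤ f 2 := sq_nonneg _
  have g1 := mul_le_mul_of_nonneg_right h1 f1
  have g2 := mul_le_mul_of_nonneg_right h2 f2
  have g3 := mul_le_mul_of_nonneg_left h3 (by positivity : 0 ≤ p / 2)
  linarith

/-- Uniform lower bound for the Abel means of the correlations of the averaged isometry. -/
lemma le_abel_sum_meanIsometry (U : H →ₗᵢ[ℝ] H) (κ : Measure ℕ)
    [IsProbabilityMeasure κ] {p : ℝ} (hp : 0 ≤ p) (h1 : p ≤ κ.real {1}) (h2 : p ≤ κ.real {2})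
    (ξ : H) {s : ℝ} (hs0 : 0 ≤ s) (hs1 : s < 1) :
    p / 8 * ‖U ξ - ξ‖ ^ 2 ≤
      2 * ∑' j : ℕ, s ^ j * inner ℝ ξ ((meanIsometry U κ ^ j) ξ) - ‖ξ‖ ^ 2 := by
  set A := meanIsometry U κ with hA
  have hA1 : ∀ u, ‖A u‖ ≤ ‖u‖ := fun u => by
    simpa using A.le_of_opNorm_le (norm_meanIsometry_le U κ) u
  have hn : ‖s • A‖ < 1 := by
    rw [norm_smul, Real.norm_of_nonneg hs0]
    exact (mul_le_of_le_one_right hs0 (norm_meanIsometry_le U κ)).trans_lt hs1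
  -- The Neumann series for (1 - sA)⁻¹ ξ; the factor s < 1 is needed because A is only known to be a
  -- contraction.
  set v := (∑' j : ℕ, (s • A) ^ j) ξ with hv
  have hfix : v - s • A v = ξ := by
    have h := congrArg (fun B : H →L[ℝ] H => B ξ) (mul_neg_geom_series (s • A) hn)
    simpa [sub_mul] using h
  have hsum : ∑' j : ℕ, s ^ j * inner ℝ ξ ((A ^ j) ξ) = inner ℝ ξ v := by
    have h := ((summable_geometric_of_norm_lt_one hn).hasSum.mapL
      ((innerSL ℝ ξ).comp (ContinuousLinearMap.apply ℝ H ξ))).tsum_eq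
    simp only [ContinuousLinearMap.comp_apply, ContinuousLinearMap.apply_apply,
      innerSL_apply_apply] at h
    rw [hv, ← h]
    refine tsum_congr fun j => ?_
    rw [smul_pow, smul_apply, real_inner_smul_right]
  have hid : 2 * inner ℝ ξ v - ‖ξ‖ ^ 2 = ‖v‖ ^ 2 - ‖s • A v‖ ^ 2 := by
    have e : s • A v = v - ξ := by rw [← hfix]; abel
    rw [e, norm_sub_sq_real, real_inner_comm]
    ring
  have hsA : ‖s • A v‖ ^ 2 ≤ ‖A v‖ ^ 2 := by
    refine pow_le_pow_left₀ (norm_nonneg _) ?_ 2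
    rw [norm_smul, Real.norm_of_nonneg hs0]
    exact mul_le_of_le_one_left (norm_nonneg _) hs1.le
  -- U commutes with A, so U ξ - ξ = (1 - sA)(U v - v), where 1 - sA has norm at most 2. This makes
  -- the final bound uniform in s.
  have hU : ‖U ξ - ξ‖ ≤ 2 * ‖U v - v‖ := by
    have e : U ξ - ξ = (U v - v) - s • A (U v - v) := by
      rw [map_sub, meanIsometry_comm_apply, ← hfix, map_sub, map_smul, smul_sub]
      abel
    rw [e]
    refine (norm_sub_le _ _).trans ?_
    rw [norm_smul, Real.norm_of_nonneg hs0, two_mul]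
    gcongr
    exact (mul_le_of_le_one_left (norm_nonneg _) hs1.le).trans (hA1 _)
  have hmain := le_norm_sq_sub_norm_meanIsometry_sq U κ hp h1 h2 v
  rw [hsum, hid]
  have h4 : ‖U ξ - ξ‖ ^ 2 ≤ 4 * ‖U v - v‖ ^ 2 := by
    refine (pow_le_pow_left₀ (norm_nonneg _) hU 2).trans_eq ?_
    ring
  have h5 := mul_le_mul_of_nonneg_left h4 (by positivity : 0 ≤ p / 8)
  linarith

end Hilbert

/-! ### Correlations along the renewal as matrix elements of the averaged isometry -/

section Renewal

variable {Ω : Type*} [MeasurableSpace Ω] {P : Measure Ω} [IsProbabilityMeasure P] {T : ℕ → Ω → ℕ}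
  {H : Type*} [NormedAddCommGroup H] [InnerProductSpace ℝ H] [CompleteSpace H]

/-- The powers of the averaged isometry are the isometry averaged over the renewal epochs. -/
lemma meanIsometry_pow (hT : IsInterarrival P T) (U : H →ₗᵢ[ℝ] H) (j : ℕ) :
    meanIsometry U (P.map (T 0)) ^ j =
      meanIsometry U (P.map fun x => epoch (fun i => T i x) j) := by
  have hm : ∀ j, Measurable fun x => epoch (fun i => T i x) j := fun j =>
    (measurable_epoch j).comp hT.measurable_seq
  have hprob : ∀ j, IsProbabilityMeasure (P.map fun x => epoch (fun i => T i x) j) := fun j =>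
    Measure.isProbabilityMeasure_map (hm j).aemeasurable
  have hprob' : IsProbabilityMeasure (P.map (T 0)) :=
    Measure.isProbabilityMeasure_map (hT.measurable 0).aemeasurable
  induction j with
  | zero =>
    simp only [epoch, Finset.range_zero, Finset.sum_empty, pow_zero]
    rw [Measure.map_const, measure_univ, one_smul, meanIsometry, integral_dirac]
    simp [isometryPow]
  | succ j ih =>
    -- The j-th epoch is independent of the next gap, so averaging U^(m + n) over their product law
    -- gives a product of operators.
    have hind : IndepFun (fun x => epoch (fun i => T i x) j) (T j) P := by
      have h := hT.indep.indepFun_sum_range_succ hT.measurable j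
      convert h using 1
      funext x
      simp [epoch]
    have hlaw := (indepFun_iff_map_prod_eq_prod_map_map (hm j).aemeasurable
      (hT.measurable j).aemeasurable).1 hind
    rw [(hT.identDistrib j).map_eq] at hlaw
    have e1 : meanIsometry U (P.map fun x => epoch (fun i => T i x) (j + 1)) =
        ∫ z : ℕ × ℕ, isometryPow U (z.1 + z.2)
          ∂((P.map fun x => epoch (fun i => T i x) j).prod (P.map (T 0))) := by
      rw [← hlaw, meanIsometry, integral_map (hm _).aemeasurable
        StronglyMeasurable.of_discrete.aestronglyMeasurable,
        integral_map ((hm j).prodMk (hT.measurable j)).aemeasurable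
        StronglyMeasurable.of_discrete.aestronglyMeasurable]
      simp [epoch, Finset.sum_range_succ]
    rw [e1, integral_prod, pow_succ, ih]
    · simp_rw [isometryPow_add]
      simp_rw [integral_const_mul_of_integrable (integrable_isometryPow U (P.map (T 0)))]
      rw [integral_mul_const_of_integrable (integrable_isometryPow U _)]
      rfl
    · exact Integrable.of_bound StronglyMeasurable.of_discrete.aestronglyMeasurable 1
        (ae_of_all _ fun z => norm_isometryPow_le U _)

end Renewal

section Disorder

variable {Ω' : Type*} [MeasurableSpace Ω'] {Q : Measure Ω'} [IsProbabilityMeasure Q]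
  {ω : ℕ → Ω' → ℝ}

/-- The correlations of a stationary sequence are those of an orbit of an isometry. -/
lemma IsStationaryGaussianDisorder.exists_linearIsometry (hω : IsStationaryGaussianDisorder Q ω) :
    ∃ (U : Lp ℝ 2 (Q.map fun y n => ω n y) →ₗᵢ[ℝ] Lp ℝ 2 (Q.map fun y n => ω n y))
      (ξ : Lp ℝ 2 (Q.map fun y n => ω n y)),
      ∀ n, inner ℝ ξ (isometryPow U n ξ) = correlation Q ω n := by
  have hmeas : AEMeasurable (fun y n => ω n y) Q := (hω.stationary 0).aemeasurable_snd
  set μ := Q.map fun y n => ω n y with hμ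
  -- Stationarity makes the coordinate shift measure preserving, and composition with it is the
  -- isometry; the orbit of the zeroth coordinate runs through all coordinates.
  have hshift : MeasurePreserving (fun (w : ℕ → ℝ) n => w (n + 1)) μ μ := by
    refine ⟨measurable_pi_iff.2 fun n => measurable_pi_apply _, ?_⟩
    rw [hμ, AEMeasurable.map_map_of_aemeasurable (Measurable.aemeasurable
      (measurable_pi_iff.2 fun n => measurable_pi_apply _)) hmeas]
    exact (hω.stationary 1).map_eq
  have hLp : ∀ n, MemLp (fun w : ℕ → ℝ => w n) 2 μ := fun n =>
    (memLp_map_measure_iff (measurable_pi_apply n).aestronglyMeasurable hmeas).2 (hω.memLp_two n)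
  refine ⟨Lp.compMeasurePreservingₗᵢ ℝ _ hshift, (hLp 0).toLp _, fun n => ?_⟩
  have hpow : isometryPow (Lp.compMeasurePreservingₗᵢ ℝ _ hshift) n ((hLp 0).toLp _) =
      (hLp n).toLp _ := by
    induction n with
    | zero => simp [isometryPow]
    | succ n ih =>
      rw [isometryPow_succ_apply, ih]
      exact Lp.toLp_compMeasurePreserving (hLp n) hshift
  rw [hpow, L2.inner_def, hω.correlation_eq]
  have h1 : ∫ w, inner ℝ (((hLp 0).toLp _ : Lp ℝ 2 μ) w) (((hLp n).toLp _ : Lp ℝ 2 μ) w) ∂μ =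
      ∫ w, w 0 * w n ∂μ := by
    refine integral_congr_ae ?_
    filter_upwards [(hLp 0).coeFn_toLp, (hLp n).coeFn_toLp] with w h0 hn
    rw [h0, hn]
    simp [mul_comm]
  rw [h1, hμ, integral_map hmeas (by fun_prop)]

end Disorder

/-! ### Positivity of the variance constant -/

section Positivity

variable {Ω Ω' : Type*} [MeasurableSpace Ω] [MeasurableSpace Ω'] {P : Measure Ω}
  [IsProbabilityMeasure P] {Q : Measure Ω'} [IsProbabilityMeasure Q] {T : ℕ → Ω → ℕ}
  {ω : ℕ → Ω' → ℝ}

/-- The variance constant in the critical curve is positive. -/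
lemma variance_constant_pos (hT : IsInterarrival P T) (hK : ∀ n, 1 ≤ n → 0 < stepLaw P T n)
    (hω : IsStationaryGaussianDisorder Q ω) (hρ : Summable fun n => |correlation Q ω n|) :
    0 < 1 + 2 * ∑' n : ℕ, correlation Q ω (n + 1) * P.real (renewalEvent T (n + 1)) := by
  obtain ⟨U, ξ, hξ⟩ := hω.exists_linearIsometry
  have hξ1 : ‖ξ‖ ^ 2 = 1 := by
    have h := hξ 0
    rw [hω.correlation_zero] at h
    rw [← h, ← real_inner_self_eq_norm_sq]
    simp [isometryPow]
  -- If U fixed ξ, all correlations would equal 1, contradicting summability.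
  have hUξ : U ξ ≠ ξ := by
    intro h
    have h1 : ∀ n, isometryPow U n ξ = ξ := by
      intro n
      induction n with
      | zero => simp [isometryPow]
      | succ n ih => rw [isometryPow_succ_apply, ih, h]
    have h2 : ∀ n, |correlation Q ω n| = 1 := fun n => by
      rw [← hξ n, h1, real_inner_self_eq_norm_sq, hξ1, abs_one]
    simp_rw [h2] at hρ
    exact one_ne_zero ((summable_const_iff _).1 hρ)
  set κ := P.map (T 0) with hκ
  have hprob : IsProbabilityMeasure κ :=
    Measure.isProbabilityMeasure_map (hT.measurable 0).aemeasurable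
  have hκn : ∀ n, κ.real {n} = stepLaw P T n := fun n =>
    map_measureReal_apply (hT.measurable 0) (measurableSet_singleton n)
  set p := min (stepLaw P T 1) (stepLaw P T 2) with hp
  have hp0 : 0 < p := lt_min (hK 1 le_rfl) (hK 2 (by norm_num))
  have he : ∀ j, inner ℝ ξ ((meanIsometry U κ ^ j) ξ) =
      meanPotential P T (correlation Q ω) j := by
    intro j
    have hm : Measurable fun x => epoch (fun i => T i x) j :=
      (measurable_epoch j).comp hT.measurable_seq
    have : IsProbabilityMeasure (P.map fun x => epoch (fun i => T i x) j) :=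
      Measure.isProbabilityMeasure_map hm.aemeasurable
    rw [meanIsometry_pow hT, meanIsometry_apply, ← integral_inner
      (integrable_isometryPow_apply U _ ξ)]
    rw [integral_congr_ae (ae_of_all _ hξ),
      integral_map hm.aemeasurable StronglyMeasurable.of_discrete.aestronglyMeasurable]
    rfl
  have hsum : Summable fun j => |meanPotential P T (correlation Q ω) j| :=
    (summable_nat_add_iff 1).1 (summable_abs_meanPotential hT hρ)
  -- Abel summation: absolute summability lets the bound, uniform over s < 1, pass to s = 1.
  have hlim : Tendsto (fun s : ℝ => ∑' j : ℕ, s ^ j * meanPotential P T (correlation Q ω) j)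
      (𝓝[<] 1) (𝓝 (∑' j, meanPotential P T (correlation Q ω) j)) := by
    refine tendsto_tsum_of_dominated_convergence hsum (fun j => ?_) ?_
    · have h : Continuous fun s : ℝ => s ^ j * meanPotential P T (correlation Q ω) j := by fun_prop
      simpa using (h.tendsto 1).mono_left (nhdsWithin_le_nhds (s := Set.Iio 1))
    · filter_upwards [Ioo_mem_nhdsLT (zero_lt_one' ℝ)] with s hs j
      rw [norm_mul, norm_pow, Real.norm_of_nonneg hs.1.le]
      exact mul_le_of_le_one_left (abs_nonneg _) (pow_le_one₀ hs.1.le hs.2.le)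
  have hle : p / 8 * ‖U ξ - ξ‖ ^ 2 ≤ 2 * ∑' j, meanPotential P T (correlation Q ω) j - 1 := by
    refine ge_of_tendsto ((hlim.const_mul 2).sub_const 1) ?_
    filter_upwards [Ioo_mem_nhdsLT (zero_lt_one' ℝ)] with s hs
    have h := le_abel_sum_meanIsometry U κ hp0.le ((min_le_left _ _).trans_eq (hκn 1).symm)
      ((min_le_right _ _).trans_eq (hκn 2).symm) ξ hs.1.le hs.2
    simp_rw [he] at h
    rwa [hξ1] at h
  -- The term j = 0 equals ρ_0 = 1, which turns 2 Σ_{j ≥ 0} - 1 into 1 + 2 Σ_{j ≥ 1}.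
  have h0 : meanPotential P T (correlation Q ω) 0 = 1 := by
    simp [meanPotential, epoch, hω.correlation_zero]
  rw [hsum.of_abs.tsum_eq_zero_add, h0, tsum_meanPotential hT hρ] at hle
  have hpos : 0 < p / 8 * ‖U ξ - ξ‖ ^ 2 := by
    have := norm_pos_iff.2 (sub_ne_zero.2 hUξ)
    positivity
  linarith

end Positivity

/-! ### The critical curve -/

section

variable {Ω Ω' : Type*} [MeasurableSpace Ω] [MeasurableSpace Ω'] {P : Measure Ω}
  [IsProbabilityMeasure P] {Q : Measure Ω'} [IsProbabilityMeasure Q] {T : ℕ → Ω → ℕ}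
  {ω : ℕ → Ω' → ℝ}

lemma tendsto_annealedPartition_iff (hT : IsInterarrival P T)
    (hω : IsStationaryGaussianDisorder Q ω) (hρ : Summable fun n => |correlation Q ω n|)
    (β h F : ℝ) :
    Tendsto (fun n : ℕ => 1 / (n : ℝ) * Real.log (annealedPartition P T Q ω n β h)) atTop (𝓝 F) ↔
      Tendsto (fun n : ℕ => Real.log (pairPartition P T (h + β ^ 2 / 2) (β ^ 2)
        (correlation Q ω) n) / n) atTop (𝓝 F) := by
  refine tendsto_congr' ?_
  filter_upwards [eventually_ge_atTop 1] with n hn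
  rw [annealedPartition_eq_sum hT hω hρ hn, pairPartition, one_div, inv_mul_eq_div]

/-- The annealed free energy is a limit. -/
lemma tendsto_annealedFreeEnergy (hT : IsInterarrival P T)
    (hK : ∀ n, 1 ≤ n → 0 < stepLaw P T n)
    (hω : IsStationaryGaussianDisorder Q ω) (hρ : Summable fun n => |correlation Q ω n|)
    (β h : ℝ) :
    Tendsto (fun n : ℕ => 1 / (n : ℝ) * Real.log (annealedPartition P T Q ω n β h)) atTop
      (𝓝 (annealedFreeEnergy P T Q ω β h)) := by
  obtain ⟨F, hF⟩ := exists_tendsto_log_pairPartition hT hK (c := h + β ^ 2 / 2) (sq_nonneg β) hρ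
  rw [← tendsto_annealedPartition_iff hT hω hρ] at hF
  rwa [annealedFreeEnergy, hF.limUnder_eq]

lemma tendsto_log_pairPartition (hT : IsInterarrival P T)
    (hK : ∀ n, 1 ≤ n → 0 < stepLaw P T n)
    (hω : IsStationaryGaussianDisorder Q ω) (hρ : Summable fun n => |correlation Q ω n|)
    (β h : ℝ) :
    Tendsto (fun n : ℕ => Real.log (pairPartition P T (h + β ^ 2 / 2) (β ^ 2)
      (correlation Q ω) n) / n) atTop (𝓝 (annealedFreeEnergy P T Q ω β h)) :=
  (tendsto_annealedPartition_iff hT hω hρ β h _).1 (tendsto_annealedFreeEnergy hT hK hω hρ β h)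

/-- The parameters with vanishing free energy lie below the second order expansion. -/
lemma le_of_annealedFreeEnergy_eq_zero (hT : IsInterarrival P T)
    (hK : ∀ n, 1 ≤ n → 0 < stepLaw P T n)
    (hω : IsStationaryGaussianDisorder Q ω) (hρ : Summable fun n => |correlation Q ω n|)
    {β h : ℝ} (h0 : annealedFreeEnergy P T Q ω β h = 0) :
    h ≤ -(β ^ 2 / 2) * (1 + 2 * ∑' n : ℕ,
      correlation Q ω (n + 1) * P.real (renewalEvent T (n + 1))) := by
  have hF := tendsto_log_pairPartition hT hK hω hρ β h
  rw [h0] at hF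
  have := le_of_freeEnergy_eq_zero hT hK (sq_nonneg β) hρ hF
  linarith

/-- The annealed critical curve is a genuine supremum. -/
lemma isLUB_annealedCriticalCurve (hT : IsInterarrival P T)
    (hKpos : ∀ n, 1 ≤ n → 0 < stepLaw P T n) {α : ℝ} {L : ℝ → ℝ} (hL : IsSlowlyVarying L)
    (hK : ∀ n : ℕ, 1 ≤ n → stepLaw P T n = L n * (n : ℝ) ^ (-(1 + α)))
    (hω : IsStationaryGaussianDisorder Q ω) (hρ : Summable fun n => |correlation Q ω n|)
    (β : ℝ) :
    IsLUB {h : ℝ | annealedFreeEnergy P T Q ω β h = 0} (annealedCriticalCurve P T Q ω β) := by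
  -- For this h one has c = -b X_1, where blocks of a single epoch already meet the criterion for
  -- nonpositive free energy.
  refine isLUB_csSup ⟨-(β ^ 2 / 2) - β ^ 2 * crossBound (correlation Q ω) 1, ?_⟩
    ⟨_, fun h hh => le_of_annealedFreeEnergy_eq_zero hT hKpos hω hρ hh⟩
  have hF := tendsto_log_pairPartition hT hKpos hω hρ β
    (-(β ^ 2 / 2) - β ^ 2 * crossBound (correlation Q ω) 1)
  refine le_antisymm (freeEnergy_nonpos_of_le hT hKpos (sq_nonneg β) hρ hF ?_)
    (nonneg_of_tendsto_log_pairPartition hT hKpos hL hK hF)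
  linarith

/-- High temperature expansion of the annealed critical curve. -/
lemma isEquivalent_annealedCriticalCurve (hT : IsInterarrival P T)
    (hKpos : ∀ n, 1 ≤ n → 0 < stepLaw P T n) {α : ℝ} {L : ℝ → ℝ} (hL : IsSlowlyVarying L)
    (hK : ∀ n : ℕ, 1 ≤ n → stepLaw P T n = L n * (n : ℝ) ^ (-(1 + α)))
    (hω : IsStationaryGaussianDisorder Q ω) (hρ : Summable fun n => |correlation Q ω n|) :
    Asymptotics.IsEquivalent (𝓝[>] (0 : ℝ))
      (fun β : ℝ => annealedCriticalCurve P T Q ω β)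
      (fun β : ℝ => -(β ^ 2 / 2) * (1 + 2 * ∑' n : ℕ,
        correlation Q ω (n + 1) * P.real (renewalEvent T (n + 1)))) := by
  have hC := variance_constant_pos hT hKpos hω hρ
  set s := ∑' n : ℕ, correlation Q ω (n + 1) * P.real (renewalEvent T (n + 1)) with hs
  refine Asymptotics.isLittleO_iff.2 fun ε hε => ?_
  -- The excess of κ over s is chosen so that the lower and upper bounds for the critical point
  -- differ by exactly ε times the modulus of the main term.
  have hκ : s < s + ε * (1 + 2 * s) / 2 := by
    have := mul_pos hε hC
    linarith
  obtain ⟨k, hk, hev⟩ := eventually_blockWeight_le hT hρ hκ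
  have hsq : Tendsto (fun β : ℝ => β ^ 2) (𝓝[>] 0) (𝓝[>] 0) := by
    refine tendsto_nhdsWithin_iff.2 ⟨?_, ?_⟩
    · have h : Continuous fun β : ℝ => β ^ 2 := by fun_prop
      simpa using (h.tendsto 0).mono_left (nhdsWithin_le_nhds (s := Set.Ioi 0))
    · filter_upwards [self_mem_nhdsWithin] with β hβ
      exact pow_pos (Set.mem_Ioi.1 hβ) 2
  filter_upwards [hsq.eventually hev] with β hβ
  have hlub := isLUB_annealedCriticalCurve hT hKpos hL hK hω hρ β
  have hupper : annealedCriticalCurve P T Q ω β ≤ -(β ^ 2 / 2) * (1 + 2 * s) :=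
    hlub.2 fun h hh => le_of_annealedFreeEnergy_eq_zero hT hKpos hω hρ hh
  have hlower : -((s + ε * (1 + 2 * s) / 2) * β ^ 2) - β ^ 2 / 2 ≤
      annealedCriticalCurve P T Q ω β := by
    refine hlub.1 ?_
    have hF := tendsto_log_pairPartition hT hKpos hω hρ β
      (-((s + ε * (1 + 2 * s) / 2) * β ^ 2) - β ^ 2 / 2)
    rw [sub_add_cancel] at hF
    exact le_antisymm (freeEnergy_nonpos_of_blockWeight_le hT hKpos (sq_nonneg β) hρ hF hk hβ)
      (nonneg_of_tendsto_log_pairPartition hT hKpos hL hK hF)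
  rw [Pi.sub_apply, Real.norm_eq_abs, Real.norm_eq_abs, abs_of_nonpos (by linarith), abs_mul,
    abs_neg, abs_of_nonneg (by positivity : 0 ≤ β ^ 2 / 2), abs_of_pos hC]
  linarith

end

end Pinning

theorem theorem2p3 {Ω Ω' : Type*} [MeasurableSpace Ω] [MeasurableSpace Ω']
    (P : Measure Ω) [IsProbabilityMeasure P] (Q : Measure Ω') [IsProbabilityMeasure Q]
    (T : ℕ → Ω → ℕ) (hT : Pinning.IsInterarrival P T)
    (α : ℝ) (hα : 0 ≤ α) (L : ℝ → ℝ) (hL : Pinning.IsSlowlyVarying L)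
    (hK : ∀ n : ℕ, 1 ≤ n → Pinning.stepLaw P T n = L n * (n : ℝ) ^ (-(1 + α)))
    (hKpos : ∀ n : ℕ, 1 ≤ n → 0 < Pinning.stepLaw P T n)
    (ω : ℕ → Ω' → ℝ) (hω : Pinning.IsStationaryGaussianDisorder Q ω)
    (hρ : Summable (fun n : ℕ => |Pinning.correlation Q ω n|)) :
    -- the annealed free energy is a genuine limit
    (∀ β h : ℝ, 0 ≤ β →
      Tendsto (fun n : ℕ => 1 / (n : ℝ) * Real.log (Pinning.annealedPartition P T Q ω n β h))
        atTop (𝓝 (Pinning.annealedFreeEnergy P T Q ω β h))) ∧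
    -- the annealed critical point is a genuine (finite) supremum
    (∀ β : ℝ, 0 ≤ β →
      IsLUB {h : ℝ | Pinning.annealedFreeEnergy P T Q ω β h = 0}
        (Pinning.annealedCriticalCurve P T Q ω β)) ∧
    -- the large-temperature asymptotics
    Asymptotics.IsEquivalent (𝓝[>] (0 : ℝ))
      (fun β : ℝ => Pinning.annealedCriticalCurve P T Q ω β)
      (fun β : ℝ => -(β ^ 2 / 2) * (1 + 2 * ∑' n : ℕ,
        Pinning.correlation Q ω (n + 1) * P.real (Pinning.renewalEvent T (n + 1)))) := by
  refine ⟨fun β h _ => Pinning.tendsto_annealedFreeEnergy hT hKpos hω hρ β h,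
    fun β _ => Pinning.isLUB_annealedCriticalCurve hT hKpos hL hK hω hρ β,
    Pinning.isEquivalent_annealedCriticalCurve hT hKpos hL hK hω hρ⟩
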